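/- **Setting.** Fix $\tau,\tau_0<\infty$ and put $\mathcal R=[0,\tau_0]\times[0,\tau]$. The event history of one subject consists of event times $T_0\le T_1\le\cdots\le\infty$, censoring times $C_m\in[T_m,T_{m+1}]$, marks $X_m\in[0,\tau]$ and $\mathbb R^d$-valued covariates $Z_m(u)$, $m\ge 0$, all measurable. Let $Y_m(u)=1(T_m<C_m,\ T_{m+1}-T_m\ge u,\ C_m-T_m\ge u)$, and let $\mathcal B\subset\mathbb R^d$ be a set of parameters. Assume that $\mathbb E\sum_m Y_m(u)e^{\beta^TZ_m(u)}<\infty$ for $u\in[0,\tau_0]$, $\beta\in\mathcal B$, and that $s(u,\beta,x)$ is a version of $\sum_m\mathbb E[Y_m(u)e^{\beta^TZ_m(u)}\mid X_m=x]f_m(x)$ ($f_m$ the density of $X_m$), that is, for these $u,\beta$, the function $s(u,\beta,\cdot)$ is a Lebesgue density on $[0,\tau]$ of the measure $A\mapsto\mathbb E\sum_mY_m(u)e^{\beta^TZ_m(u)}1(X_m\in A)$. Assume that $s>0$ on $[0,\tau_0]\times\mathcal B\times[0,\tau]$. Let $W_1,W_2,\dots$ be i.i.d. observations of such histories, with common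 law $P$. For an integer $\kappa\ge1$ let $C(\kappa)=2(2\kappa+1)\binom{2\kappa-1}{\kappa}$ and $$K_{11}(r)=2C(\kappa)2^{-(2\kappa+2)}(1+r)^\kappa(1-r)^\kappa,$$ $$K_{1q}(r)=C(\kappa)(1+q)^{-(2\kappa+2)}(1+r)^\kappa(q-r)^{\kappa-1}\left[2r((1-q)\kappa-q)+\kappa(1-q)^2+2q^2\right],$$ $$K_{p1}(r)=C(\kappa)(p+1)^{-(2\kappa+2)}(p+r)^{\kappa-1}(1-r)^{\kappa}\left[2r((p-1)\kappa+p)+\kappa(p-1)^2+2p^2\right].$$ For a bandwidth $a=a_n>0$, the boundary kernel is $$K_n(x,w)=\begin{cases}1(|x-w|\le a)\,K_{11}\!\left(\tfrac{x-w}{a}\right), & a<x<\tau-a,\\ 1(0\le w\le(1+q)a)\,K_{1q}\!\left(q-\tfrac wa\right),\ q=\tfrac xa, & 0<x\le a,\\ 1(\tau-(1+p)a\le w\le\tau)\,K_{p1}\!\left(\tfrac{\tau-w}{a}-p\right),\ p=\tfrac{\tau-x}{a}, & \tau-a\le x\le\tau.\end{cases}$$ Let $$S_i(u,\beta,x)=\sum_mY_{im}(u)e^{\beta^TZ_{im}(u)}K_n(x,X_{im}),\qquad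 h(u,\beta,x)=s(u,\beta,x)^{-1}\sum_mY_m(u)e^{\beta^TZ_m(u)}K_n(x,X_m),$$ $S_{-i}=\frac1{(n-1)a_n}\sum_{j\le n,\,j\ne i}S_j$ and $\bar s=a_n^{-1}\mathbb E S_1$. Let $\mathcal R_{1n}=\{(u,x)\in\mathcal R:a_n\le x\le\tau-a_n\}$, $\mathcal R_{2n}=\{(u,x)\in\mathcal R:0<x\le a_n\}$, $\mathcal R_{3n}=\{(u,x)\in\mathcal R:\tau-a_n<x\le\tau\}$, let $\mathcal H_{pn}=\{h(u,\beta,x):(u,x)\in\mathcal R_{pn},\beta\in\mathcal B\}$ and, with outer expectations (ordinary ones if the supremum is measurable), $$\mu_{pn}=\mathbb E\sup_{(u,x)\in\mathcal R_{pn},\,\beta\in\mathcal B}\left|\frac1{na_n}\sum_{i=1}^n\left(h(u,\beta,x)(W_i)-\mathbb E h(u,\beta,x)\right)\right|,\qquad \mu'_{pn}=\max_{i\le n}\mathbb E\sup_{(u,x)\in\mathcal R_{pn},\,\beta\in\mathcal B}\left|\frac{S_{-i}-\bar s}{s}\right|(u,\beta,x).$$ Write $N_{[]}(\eta,\mathcal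 H,\|\cdot\|_{L_2(P)})$ for the minimal number of brackets $[l,u]$ with $l,u\in L_2(P)$ and $\|u-l\|_{L_2(P)}\le\eta$ that cover $\mathcal H$. An envelope of $\mathcal H$ is a random variable $H$ such that almost surely $|h|\le H$ for all $h\in\mathcal H$ simultaneously. **Proposition 3.6.** Suppose that for some $r>2$ we have $a_n\to0$, $na_n\to\infty$, $b_n=\log(a_n^{-1})/(na_n)\to0$ and $a_n^{-1}b_n^{r/2-1}=O(1)$. Suppose that there are random variables $H_{1n}$ such that, for all large $n$, $H_{1n}$ is an envelope of $\mathcal H_{1n}$, and 1. $\mathbb E H_{1n}^r=O(1)$; 2. $\|h\|_{L_2(P)}\le\sqrt{a_n}\,\|H_{1n}\|_{L_2(P)}$ for all $h\in\mathcal H_{1n}$ and all large $n$; 3. there are constants $A,V\in(0,\infty)$ such that, for all large $n$ and all $\epsilon\in(0,1)$, $N_{[]}(\epsilon\|H_{1n}\|_{L_2(P)},\mathcal H_{1n},\|\cdot\|_{L_2(P)})\le(A\epsilon^{-1})^V$. Then $\mu_{1n}=O(\sqrt{b_n})$ and $\mu'_{1n}=O(\sqrt{b_n})$. Let $p\in\{2,3\}$.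 If in addition there are random variables $H_{pn}$ such that, for all large $n$, $H_{pn}$ is an envelope of $\mathcal H_{pn}$, and 4. $\mathbb E H_{pn}^2=O(a_n)$; 5. there are constants $A_p,V_p\in(0,\infty)$ such that, for all large $n$ and all $\epsilon\in(0,1)$, $N_{[]}(\epsilon\|H_{pn}\|_{L_2(P)},\mathcal H_{pn},\|\cdot\|_{L_2(P)})\le(A_p\epsilon^{-1})^{V_p}$, then $\mu_{pn}=O((na_n)^{-1/2})$ and $\mu'_{pn}=O((na_n)^{-1/2})$. -/

import Mathlib

open MeasureTheory ProbabilityTheory Filter Set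
open scoped ENNReal NNReal Topology

noncomputable section

namespace KernelRisk

/-! ### General notions -/

/-- Outer expectation of a `[0, ∞]`-valued map: the infimum of the integrals of its measurable
majorants. It is the usual expectation whenever the map is measurable; it is used because a
supremum over an uncountable index set need not be measurable. -/
def outerExpectation {Ω : Type*} [MeasurableSpace Ω] (Q : Measure Ω) (f : Ω → ℝ≥0∞) : ℝ≥0∞ :=
  ⨅ (g : Ω → ℝ≥0∞) (_ : Measurable g) (_ : ∀ ω, f ω ≤ g ω), ∫⁻ ω, g ω ∂Q

/-- `f n = O(g n)` as `n → ∞`, for `f` with values in `[0, ∞]`. -/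
def IsOrder (f : ℕ → ℝ≥0∞) (g : ℕ → ℝ) : Prop :=
  ∃ C : ℝ≥0, ∀ᶠ n in atTop, f n ≤ C * ENNReal.ofReal (g n)

/-- The bracketing number `N_[](η, F, L₂(P))`: the least number of brackets `[l, u]`, with
`l` and `u` in `L₂(P)` and `‖u - l‖_{L₂(P)} ≤ η`, that cover `F` (it is `⊤` if there is no
finite cover). -/
def bracketingNumber {S : Type*} [MeasurableSpace S] (P : Measure S) (F : Set (S → ℝ))
    (η : ℝ≥0∞) : ℕ∞ :=
  ⨅ (N : ℕ) (_ : ∃ l u : Fin N → S → ℝ,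
    (∀ j, MemLp (l j) 2 P ∧ MemLp (u j) 2 P ∧ eLpNorm (fun w => u j w - l j w) 2 P ≤ η) ∧
    ∀ f ∈ F, ∃ j, ∀ w, l j w ≤ f w ∧ f w ≤ u j w), (N : ℕ∞)

/-- The classes `F n` have polynomial bracketing numbers relative to `‖H n‖_{L₂(P)}`, with
constants that do not depend on `n` and `ε`. -/
def PolynomialBracketing {S : Type*} [MeasurableSpace S] (P : Measure S)
    (F : ℕ → Set (S → ℝ)) (H : ℕ → S → ℝ) : Prop :=
  ∃ A V : ℝ, 0 < A ∧ 0 < V ∧ ∀ᶠ n in atTop, ∀ ε ∈ Ioo (0 : ℝ) 1,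
    ((bracketingNumber P (F n) (ENNReal.ofReal ε * eLpNorm (H n) 2 P) : ℕ∞) : ℝ≥0∞)
      ≤ ENNReal.ofReal ((A / ε) ^ V)

/-- `H` is an envelope of the class `F`, almost surely. -/
def IsEnvelope {S : Type*} [MeasurableSpace S] (P : Measure S) (F : Set (S → ℝ))
    (H : S → ℝ) : Prop :=
  ∀ᵐ w ∂P, ∀ f ∈ F, |f w| ≤ H w

/-! ### The boundary kernel -/

/-- `C(κ) = 2 (2κ + 1) (2κ - 1 choose κ)`. -/
def kernelConst (κ : ℕ) : ℝ := 2 * (2 * κ + 1) * ((2 * κ - 1).choose κ : ℝ)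

/-- The kernel `K₁₁` of the central region. -/
def kernelCentral (κ : ℕ) (r : ℝ) : ℝ :=
  2 * kernelConst κ * (1 / 2) ^ (2 * κ + 2) * (1 + r) ^ κ * (1 - r) ^ κ

/-- The polynomial `K_{pq}` of the left boundary region. -/
def kernelLeft (κ : ℕ) (p q r : ℝ) : ℝ :=
  kernelConst κ * (1 / (p + q)) ^ (2 * κ + 2) * (p + r) ^ κ * (q - r) ^ (κ - 1) *
    (2 * r * ((p - q) * κ - q) + κ * (p - q) ^ 2 + 2 * q ^ 2)

/-- The polynomial `K_{pq}` of the right boundary region. -/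
def kernelRight (κ : ℕ) (p q r : ℝ) : ℝ :=
  kernelConst κ * (1 / (p + q)) ^ (2 * κ + 2) * (p + r) ^ (κ - 1) * (q - r) ^ κ *
    (2 * r * ((p - q) * κ + p) + κ * (p - q) ^ 2 + 2 * p ^ 2)

/-- The boundary kernel `K_n(x, w)` on `[0, τ]` with bandwidth `a`. In the left region
`q = x / a` and in the right region `p = (τ - x) / a`; in all three cases the polynomial is
evaluated at `(x - w) / a`, and the window is `{w ∈ [0, τ] : |x - w| ≤ a}` when `2 a ≤ τ`. -/
def boundaryKernel (κ : ℕ) (τ a x w : ℝ) : ℝ :=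
  if a < x ∧ x < τ - a then
    if x - a ≤ w ∧ w ≤ x + a then kernelCentral κ ((x - w) / a) else 0
  else if 0 < x ∧ x ≤ a then
    if 0 ≤ w ∧ w ≤ (1 + x / a) * a then kernelLeft κ 1 (x / a) (x / a - w / a) else 0
  else if τ - a ≤ x ∧ x ≤ τ then
    if τ - (1 + (τ - x) / a) * a ≤ w ∧ w ≤ τ then
      kernelRight κ ((τ - x) / a) 1 ((τ - w) / a - (τ - x) / a)
    else 0
  else 0

/-! ### The observation of one subject -/

/-- The event history of one subject, on the sample space `S` of one observation: event times
`T m` (equal to `∞` if the `m`-th event does not occur), censoring times `C m ∈ [T m, T (m+1)]`,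
marks `X m ∈ [0, τ]`, and covariates `Z m u` at duration `u` after the `m`-th event. Further
properties of the process (strict monotonicity and non-explosion of the event times, left
continuity of the covariates, form of the intensities) are not required. -/
structure EventHistory (S : Type*) [MeasurableSpace S] (d : ℕ) (τ : ℝ) where
  T : ℕ → S → ℝ≥0∞
  C : ℕ → S → ℝ≥0∞
  X : ℕ → S → ℝ
  Z : ℕ → ℝ → S → Fin d → ℝ
  measurable_T : ∀ m, Measurable (T m)
  measurable_C : ∀ m, Measurable (C m)
  measurable_X : ∀ m, Measurable (X m)
  measurable_Z : ∀ m u, Measurable (Z m u)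
  T_mono : ∀ m w, T m w ≤ T (m + 1) w
  T_le_C : ∀ m w, T m w ≤ C m w
  C_le_T : ∀ m w, C m w ≤ T (m + 1) w
  X_mem : ∀ m w, X m w ∈ Icc 0 τ

section

variable {S : Type*} [MeasurableSpace S] {d : ℕ} {τ : ℝ}

/-- The at-risk indicator `Y_m(v)`. The spell has to be under observation (`T m < C m`), which
matters at `v = 0` only. -/
def atRisk (D : EventHistory S d τ) (m : ℕ) (v : ℝ) (w : S) : ℝ :=
  open Classical in
  if D.T m w < D.C m w ∧ ENNReal.ofReal v ≤ D.T (m + 1) w - D.T m w ∧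
    ENNReal.ofReal v ≤ D.C m w - D.T m w then 1 else 0

/-- `Y_m(u) exp(βᵀ Z_m(u))`. -/
def riskWeight (D : EventHistory S d τ) (m : ℕ) (u : ℝ) (β : Fin d → ℝ) (w : S) : ℝ :=
  atRisk D m u w * Real.exp (β ⬝ᵥ D.Z m u w)

/-- `E ∑_m Y_m(u) exp(βᵀ Z_m(u)) < ∞` for `u ∈ [0, τ₀]` and `β ∈ B`. -/
def FiniteRisk (P : Measure S) (D : EventHistory S d τ) (τ₀ : ℝ) (B : Set (Fin d → ℝ)) : Prop :=
  ∀ u ∈ Icc 0 τ₀, ∀ β ∈ B,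
    (∑' m, (∫⁻ w, ENNReal.ofReal (riskWeight D m u β w) ∂P)) < ∞

/-- `s` is a version of the function
`s(u, β, x) = ∑_m E(Y_m(u) exp(βᵀ Z_m(u)) | X_m = x) f_m(x)`, `f_m` the density of `X_m`:
`s(u, β, ·)` is a Lebesgue density on `[0, τ]` of the measure
`A ↦ E ∑_m Y_m(u) exp(βᵀ Z_m(u)) 1(X_m ∈ A)`. -/
def IsRiskDensity (P : Measure S) (D : EventHistory S d τ) (τ₀ : ℝ) (B : Set (Fin d → ℝ))
    (s : ℝ → (Fin d → ℝ) → ℝ → ℝ) : Prop :=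
  ∀ u ∈ Icc 0 τ₀, ∀ β ∈ B, Measurable (s u β) ∧
    (volume.restrict (Icc 0 τ)).withDensity (fun x => ENNReal.ofReal (s u β x)) =
      Measure.sum fun m =>
        (P.withDensity fun w => ENNReal.ofReal (riskWeight D m u β w)).map (D.X m)

/-- `S_i^{(0)}(u, β, x) = ∑_m Y_m(u) exp(βᵀ Z_m(u)) K_n(x, X_m)`, as a function of the
observation `w` of the subject. -/
def riskTerm (D : EventHistory S d τ) (κ : ℕ) (a u : ℝ) (β : Fin d → ℝ) (x : ℝ) (w : S) : ℝ :=
  ∑' m, riskWeight D m u β w * boundaryKernel κ τ a x (D.X m w)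

/-- `h(u, β, x) = s(u, β, x)⁻¹ ∑_m Y_m(u) exp(βᵀ Z_m(u)) K_n(x, X_m)`. -/
def normalizedTerm (D : EventHistory S d τ) (s : ℝ → (Fin d → ℝ) → ℝ → ℝ) (κ : ℕ)
    (a u : ℝ) (β : Fin d → ℝ) (x : ℝ) (w : S) : ℝ :=
  (s u β x)⁻¹ * riskTerm D κ a u β x w

/-- The class of functions `h(u, β, x)` with `(u, x)` in a region `G` and `β ∈ B`. -/
def termClass (D : EventHistory S d τ) (s : ℝ → (Fin d → ℝ) → ℝ → ℝ) (κ : ℕ)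
    (a : ℝ) (B : Set (Fin d → ℝ)) (G : Set (ℝ × ℝ)) : Set (S → ℝ) :=
  {f | ∃ z ∈ G, ∃ β ∈ B, f = normalizedTerm D s κ a z.1 β z.2}

/-- `sup |(n a)⁻¹ ∑_{i < n} (h(u, β, x)(W_i) - E h(u, β, x))|` over `(u, x) ∈ G`, `β ∈ B`, where
`n` is the sample size and `W i` is the observation of subject `i`. -/
def supDeviation (P : Measure S) (D : EventHistory S d τ) (s : ℝ → (Fin d → ℝ) → ℝ → ℝ)
    (κ : ℕ) (a : ℝ) (B : Set (Fin d → ℝ)) (G : Set (ℝ × ℝ)) {Ω : Type*} (W : ℕ → Ω → S)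
    (n : ℕ) (ω : Ω) : ℝ≥0∞ :=
  ⨆ z ∈ G, ⨆ β ∈ B, ENNReal.ofReal |(n * a)⁻¹ * ∑ i ∈ Finset.range n,
    (normalizedTerm D s κ a z.1 β z.2 (W i ω) - ∫ w, normalizedTerm D s κ a z.1 β z.2 w ∂P)|

/-- The leave-one-out risk process
`S_{-i}^{(0)}(u, β, x) = ((n - 1) a)⁻¹ ∑_{j ≠ i} S_j^{(0)}(u, β, x)`. -/
def leaveOneOut (D : EventHistory S d τ) (κ : ℕ) (a : ℝ) {Ω : Type*} (W : ℕ → Ω → S)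
    (n i : ℕ) (u : ℝ) (β : Fin d → ℝ) (x : ℝ) (ω : Ω) : ℝ :=
  (((n : ℝ) - 1) * a)⁻¹ * ∑ j ∈ (Finset.range n).erase i, riskTerm D κ a u β x (W j ω)

/-- `sbar^{(0)}(u, β, x) = a⁻¹ E S_i^{(0)}(u, β, x)`. -/
def meanRisk (P : Measure S) (D : EventHistory S d τ) (κ : ℕ) (a u : ℝ) (β : Fin d → ℝ)
    (x : ℝ) : ℝ :=
  a⁻¹ * ∫ w, riskTerm D κ a u β x w ∂P

/-- `sup |(S_{-i}^{(0)} - sbar^{(0)}) / s|(u, β, x)` over `(u, x) ∈ G`, `β ∈ B`. -/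
def supLeaveOneOut (P : Measure S) (D : EventHistory S d τ) (s : ℝ → (Fin d → ℝ) → ℝ → ℝ)
    (κ : ℕ) (a : ℝ) (B : Set (Fin d → ℝ)) (G : Set (ℝ × ℝ)) {Ω : Type*} (W : ℕ → Ω → S)
    (n i : ℕ) (ω : Ω) : ℝ≥0∞ :=
  ⨆ z ∈ G, ⨆ β ∈ B, ENNReal.ofReal
    |(leaveOneOut D κ a W n i z.1 β z.2 ω - meanRisk P D κ a z.1 β z.2) / s z.1 β z.2|

/-- The expected uniform deviations over the regions `G n` with bandwidths `a n` are `O(rate n)`,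
both for the whole sample (the quantity `μ_n`) and, uniformly in the subject that is left
out, for the leave-one-out risk processes. -/
def DeviationOrder (P : Measure S) (D : EventHistory S d τ) (s : ℝ → (Fin d → ℝ) → ℝ → ℝ)
    (κ : ℕ) (a : ℕ → ℝ) (B : Set (Fin d → ℝ)) (G : ℕ → Set (ℝ × ℝ)) {Ω : Type*}
    [MeasurableSpace Ω] (Q : Measure Ω) (W : ℕ → Ω → S) (rate : ℕ → ℝ) : Prop :=
  IsOrder (fun n => outerExpectation Q (supDeviation P D s κ (a n) B (G n) W n)) rate ∧
  IsOrder (fun n => ⨆ i ∈ Finset.range n,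
    outerExpectation Q (supLeaveOneOut P D s κ (a n) B (G n) W n i)) rate

end

/-! ### Regions and rate -/

/-- The central region `{(u, x) ∈ [0, τ₀] × [0, τ] : a ≤ x ≤ τ - a}`. -/
def centralRegion (τ₀ τ a : ℝ) : Set (ℝ × ℝ) :=
  {z | z.1 ∈ Icc 0 τ₀ ∧ z.2 ∈ Icc 0 τ ∧ a ≤ z.2 ∧ z.2 ≤ τ - a}

/-- The left boundary region `{(u, x) ∈ [0, τ₀] × [0, τ] : 0 < x ≤ a}`. -/
def leftRegion (τ₀ τ a : ℝ) : Set (ℝ × ℝ) :=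
  {z | z.1 ∈ Icc 0 τ₀ ∧ z.2 ∈ Icc 0 τ ∧ 0 < z.2 ∧ z.2 ≤ a}

/-- The right boundary region `{(u, x) ∈ [0, τ₀] × [0, τ] : τ - a < x ≤ τ}`. -/
def rightRegion (τ₀ τ a : ℝ) : Set (ℝ × ℝ) :=
  {z | z.1 ∈ Icc 0 τ₀ ∧ z.2 ∈ Icc 0 τ ∧ τ - a < z.2 ∧ z.2 ≤ τ}

/-- `b_n = log(a_n⁻¹) / (n a_n)`. -/
def logRate (a : ℕ → ℝ) (n : ℕ) : ℝ := Real.log ((a n)⁻¹) / (n * a n)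

end KernelRisk

end

noncomputable section

namespace KernelRisk

/-! ### Expected suprema of families of random variables -/

section ExpectedSup

variable {Ω : Type*} [MeasurableSpace Ω] {Q : Measure Ω} {ι κ : Type*}

/-! The functions `h` enter only through their measurability, envelopes, `L₂` norms and bracketing
numbers. What carries the theorem is a maximal inequality for empirical processes under bracketing,
with constants that do not depend on `n`. Suprema are controlled by integrable majorants
(`ExpectedSupLE`), which can be added and need no measurability of the supremum. Outer expectations
appear only at the end.

For finitely many functions bounded by `t`, whose second moment times the sample size is at most `t²
L` and whose number is at most `exp L / 2`, exponential moments bound the expected maximum of the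
centred sums by a multiple of `t L` (`expectedSupLE_finite`).

An infinite class is reduced to this case by chaining. Each function runs through nested brackets of
`L₂` size `σ 2⁻ᵏ`. It is written as a starting point plus increments of the lower ends, followed as
long as the bracket widths stay below truncation levels `t k`. The error is at most the width at the
level where a truncation level is first exceeded, or the width at the end, plus a multiple of the
envelope where it is large (`abs_sub_chain_le`). The widths depend on finitely many indices and are
again handled by the finite inequality. Their means are small because a width exceeding `t` is at
most its square divided by `t`. When the number of brackets at level `k` is at most `exp (L (k + 1))
/ 2`, the levels contribute a convergent series and the total is of order `√n σ √L` plus `n` times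
the mean of the envelope tail beyond `√n σ / √L` (`expectedSupLE_bracketing`).

In the central region `σ` is of order `√a`, and polynomial bracketing makes `L` of order `log a⁻¹`,
so that `√n σ √L` is of order `n a √b`. The `r`-th moment makes the tail of order `n b^((r-1)/2)`,
and the condition on `a⁻¹ b^(r/2-1)` turns this into `n a √b`. At the boundary the envelope itself
has norm of order `√a`, so the relative bracket sizes do not shrink with `a`; hence `L` is constant
and the logarithm disappears. A leave-one-out process is a rescaled centred sum over `n - 1`
subjects, covered by stating the bounds for all subsamples of at least `n / 2` subjects. -/

/-- `sup_i |X i|` has an integrable majorant with expectation at most `b`. -/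
def ExpectedSupLE (Q : Measure Ω) (X : ι → Ω → ℝ) (b : ℝ) : Prop :=
  ∃ G : Ω → ℝ, Integrable G Q ∧ (∀ᵐ ω ∂Q, ∀ i, |X i ω| ≤ G ω) ∧ ∫ ω, G ω ∂Q ≤ b

theorem ExpectedSupLE.mono {X : ι → Ω → ℝ} {b c : ℝ} (h : ExpectedSupLE Q X b) (hbc : b ≤ c) :
    ExpectedSupLE Q X c := by
  obtain ⟨G, hG, hX, hb⟩ := h
  exact ⟨G, hG, hX, hb.trans hbc⟩

theorem ExpectedSupLE.of_abs_le {X Y : ι → Ω → ℝ} {b : ℝ} (h : ExpectedSupLE Q X b)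
    (hY : ∀ᵐ ω ∂Q, ∀ i, |Y i ω| ≤ |X i ω|) : ExpectedSupLE Q Y b := by
  obtain ⟨G, hG, hX, hb⟩ := h
  refine ⟨G, hG, ?_, hb⟩
  filter_upwards [hX, hY] with ω h1 h2 i using (h2 i).trans (h1 i)

theorem ExpectedSupLE.reindex {X : ι → Ω → ℝ} {b : ℝ} (h : ExpectedSupLE Q X b) (e : κ → ι) :
    ExpectedSupLE Q (fun k => X (e k)) b := by
  obtain ⟨G, hG, hX, hb⟩ := h
  refine ⟨G, hG, ?_, hb⟩
  filter_upwards [hX] with ω h1 i using h1 _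

theorem ExpectedSupLE.add {X Y : ι → Ω → ℝ} {b c : ℝ} (hX : ExpectedSupLE Q X b)
    (hY : ExpectedSupLE Q Y c) : ExpectedSupLE Q (fun i ω => X i ω + Y i ω) (b + c) := by
  obtain ⟨G, hG, hXG, hb⟩ := hX
  obtain ⟨G', hG', hYG, hc⟩ := hY
  refine ⟨fun ω => G ω + G' ω, hG.add hG', ?_, ?_⟩
  · filter_upwards [hXG, hYG] with ω h1 h2 i
    exact (abs_add_le _ _).trans (add_le_add (h1 i) (h2 i))
  · rw [integral_add hG hG']
    exact add_le_add hb hc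

theorem ExpectedSupLE.sum {X : ℕ → ι → Ω → ℝ} {b : ℕ → ℝ} (s : Finset ℕ)
    (h : ∀ k ∈ s, ExpectedSupLE Q (X k) (b k)) :
    ExpectedSupLE Q (fun i ω => ∑ k ∈ s, X k i ω) (∑ k ∈ s, b k) := by
  classical
  induction s using Finset.induction_on with
  | empty => exact ⟨0, integrable_zero _ _ _, by simp, by simp⟩
  | insert k s hk ih =>
    simp only [Finset.sum_insert hk]
    exact (h k (Finset.mem_insert_self _ _)).add
      (ih fun j hj => h j (Finset.mem_insert_of_mem hj))

theorem ExpectedSupLE.const [IsProbabilityMeasure Q] {c : ι → ℝ} {b : ℝ} (h : ∀ i, |c i| ≤ b) :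
    ExpectedSupLE Q (fun i (_ : Ω) => c i) b :=
  ⟨fun _ => b, integrable_const _, ae_of_all _ fun _ i => h i, by simp⟩

theorem ExpectedSupLE.const_mul {X : ι → Ω → ℝ} {b : ℝ} (c : ℝ) (h : ExpectedSupLE Q X b) :
    ExpectedSupLE Q (fun i ω => c * X i ω) (|c| * b) := by
  obtain ⟨G, hG, hX, hb⟩ := h
  refine ⟨fun ω => |c| * G ω, hG.const_mul _, ?_, ?_⟩
  · filter_upwards [hX] with ω h1 i
    rw [abs_mul]
    exact mul_le_mul_of_nonneg_left (h1 i) (abs_nonneg _)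
  · rw [integral_const_mul]
    exact mul_le_mul_of_nonneg_left hb (abs_nonneg _)

end ExpectedSup

/-! ### A maximal inequality for finite classes of bounded functions -/

section Finite

variable {S Ω : Type*} [MeasurableSpace S] {P : Measure S} {W : ℕ → Ω → S}

/-- The centred sum `∑_{i ∈ I} (g(W i) - P g)`. -/
def centredSum (P : Measure S) (W : ℕ → Ω → S) (I : Finset ℕ) (g : S → ℝ) (ω : Ω) : ℝ :=
  ∑ i ∈ I, (g (W i ω) - ∫ w, g w ∂P)

theorem centredSum_add {g h : S → ℝ} (hg : Integrable g P) (hh : Integrable h P) (I : Finset ℕ)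
    (ω : Ω) : centredSum P W I (fun w => g w + h w) ω
      = centredSum P W I g ω + centredSum P W I h ω := by
  simp only [centredSum, integral_add hg hh, ← Finset.sum_add_distrib]
  exact Finset.sum_congr rfl fun i _ => by ring

theorem centredSum_sum {g : ℕ → S → ℝ} (s : Finset ℕ) (hg : ∀ k ∈ s, Integrable (g k) P)
    (I : Finset ℕ) (ω : Ω) : centredSum P W I (fun w => ∑ k ∈ s, g k w) ω
      = ∑ k ∈ s, centredSum P W I (g k) ω := by
  simp only [centredSum, integral_finsetSum s hg, ← Finset.sum_sub_distrib]
  exact Finset.sum_comm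

/-- On `[-1, 1]` one has `exp x ≤ 1 + x + x²`. The linear term has mean zero and the variance is at
most the second moment; `1 + y ≤ exp y` finishes. -/
theorem integral_exp_centred_le [IsProbabilityMeasure P] {g : S → ℝ} (hg : Measurable g)
    {t lam : ℝ} (hlam : |lam| * (2 * t) ≤ 1) (hgt : ∀ w, |g w| ≤ t) :
    ∫ w, Real.exp (lam * (g w - ∫ v, g v ∂P)) ∂P ≤ Real.exp (lam ^ 2 * ∫ w, g w ^ 2 ∂P) := by
  set c := ∫ v, g v ∂P with hc
  have hgi : Integrable g P := Integrable.of_bound hg.aestronglyMeasurable t (ae_of_all _ hgt)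
  have hct : |c| ≤ t := by
    have := norm_integral_le_of_norm_le_const (μ := P) (f := g) (ae_of_all P hgt)
    simpa [hc] using this
  have hg2 : Integrable (fun w => g w ^ 2) P := by
    refine Integrable.of_bound (hg.pow_const 2).aestronglyMeasurable (t ^ 2) (ae_of_all _ fun w => ?_)
    rw [Real.norm_eq_abs, abs_pow]
    exact pow_le_pow_left₀ (abs_nonneg _) (hgt w) 2
  have hb : ∀ w, |lam * (g w - c)| ≤ 1 := fun w => by
    rw [abs_mul]
    refine le_trans (mul_le_mul_of_nonneg_left ?_ (abs_nonneg _)) hlam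
    have := abs_sub (g w) c
    linarith [hgt w]
  have hpt : ∀ w, Real.exp (lam * (g w - c)) ≤
      1 + lam * (g w - c) + lam ^ 2 * (g w ^ 2 - 2 * c * g w + c ^ 2) := fun w => by
    have := (abs_le.1 (Real.abs_exp_sub_one_sub_id_le (hb w))).2
    nlinarith
  have hint : ∫ w, (1 + lam * (g w - c) + lam ^ 2 * (g w ^ 2 - 2 * c * g w + c ^ 2)) ∂P
      = 1 + lam ^ 2 * (∫ w, g w ^ 2 ∂P) - lam ^ 2 * c ^ 2 := by
    have h1 : Integrable (fun w => lam * (g w - c)) P :=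
      (hgi.sub (integrable_const c)).const_mul lam
    have h2 : Integrable (fun w => g w ^ 2 - 2 * c * g w) P := hg2.sub (hgi.const_mul _)
    have h3 : Integrable (fun w => lam ^ 2 * (g w ^ 2 - 2 * c * g w + c ^ 2)) P :=
      (h2.add (integrable_const _)).const_mul _
    have h4 : Integrable (fun w => 1 + lam * (g w - c)) P := (integrable_const _).add h1
    rw [integral_add h4 h3, integral_add (integrable_const _) h1,
      integral_const_mul, integral_const_mul, integral_add h2 (integrable_const _),
      integral_sub hg2 (hgi.const_mul _), integral_sub hgi (integrable_const _),
      integral_const_mul, ← hc]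
    simp
    ring
  have hexp : Integrable (fun w => Real.exp (lam * (g w - c))) P := by
    refine Integrable.of_bound (by fun_prop) (Real.exp 1) (ae_of_all _ fun w => ?_)
    rw [Real.norm_eq_abs, Real.abs_exp]
    exact Real.exp_le_exp.2 (abs_le.1 (hb w)).2
  calc ∫ w, Real.exp (lam * (g w - c)) ∂P
      ≤ ∫ w, (1 + lam * (g w - c) + lam ^ 2 * (g w ^ 2 - 2 * c * g w + c ^ 2)) ∂P := by
        refine integral_mono hexp ?_ hpt
        exact ((integrable_const _).add ((hgi.sub (integrable_const c)).const_mul lam)).add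
          (((hg2.sub (hgi.const_mul _)).add (integrable_const _)).const_mul _)
    _ ≤ lam ^ 2 * (∫ w, g w ^ 2 ∂P) + 1 := by rw [hint]; nlinarith [sq_nonneg (lam * c)]
    _ ≤ _ := Real.add_one_le_exp _

variable [MeasurableSpace Ω] {Q : Measure Ω}

/-- By independence the exponential moment of the sum is the product of the individual ones.
Boundedness gives integrability. -/
theorem integral_exp_centredSum_le [IsProbabilityMeasure P] [IsProbabilityMeasure Q]
    (hW : ∀ i, MeasurePreserving (W i) Q P) (hind : iIndepFun W Q) (I : Finset ℕ) {g : S → ℝ}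
    (hg : Measurable g) {t lam : ℝ} (hlam : |lam| * (2 * t) ≤ 1) (hgt : ∀ w, |g w| ≤ t) :
    Integrable (fun ω => Real.exp (lam * centredSum P W I g ω)) Q ∧
    ∫ ω, Real.exp (lam * centredSum P W I g ω) ∂Q
      ≤ Real.exp (lam ^ 2 * (I.card * ∫ w, g w ^ 2 ∂P)) := by
  set c := ∫ v, g v ∂P with hc
  have hct : |c| ≤ t := by
    have := norm_integral_le_of_norm_le_const (μ := P) (f := g) (ae_of_all P hgt)
    simpa [hc] using this
  let Y : ℕ → Ω → ℝ := fun i => (fun w => g w - c) ∘ W i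
  have hYm : ∀ i, Measurable (Y i) := fun i => (hg.sub_const c).comp (hW i).measurable
  have hYi : iIndepFun Y Q := hind.comp (fun _ w => g w - c) fun _ => hg.sub_const c
  have hsum : ∀ ω, centredSum P W I g ω = (∑ i ∈ I, Y i) ω := fun ω => by
    simp [centredSum, Y, hc]
  constructor
  · refine Integrable.of_bound (C := Real.exp (|lam| * (I.card * (2 * t)))) ?_
      (ae_of_all _ fun ω => ?_)
    · have : Measurable fun ω => ∑ i ∈ I, Y i ω := Finset.measurable_sum _ fun i _ => hYm i
      simp only [hsum, Finset.sum_apply]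
      exact (Real.measurable_exp.comp (this.const_mul lam)).aestronglyMeasurable
    · rw [Real.norm_eq_abs, Real.abs_exp]
      refine Real.exp_le_exp.2 ((le_abs_self _).trans ?_)
      rw [abs_mul]
      refine mul_le_mul_of_nonneg_left ?_ (abs_nonneg _)
      refine (Finset.abs_sum_le_sum_abs _ _).trans ?_
      rw [← nsmul_eq_mul]
      refine Finset.sum_le_card_nsmul _ _ _ fun i _ => ?_
      have := abs_sub (g (W i ω)) c
      linarith [hgt (W i ω)]
  · have h1 := hYi.mgf_sum hYm (t := lam) I
    have h2 : ∀ i, mgf (Y i) Q lam ≤ Real.exp (lam ^ 2 * ∫ w, g w ^ 2 ∂P) := fun i => by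
      refine le_trans (le_of_eq ?_) (integral_exp_centred_le hg hlam hgt)
      rw [← (hW i).map_eq, integral_map (hW i).measurable.aemeasurable]
      · simp [mgf, Y, hc, (hW i).map_eq]
      · exact Measurable.aestronglyMeasurable (by fun_prop)
    calc ∫ ω, Real.exp (lam * centredSum P W I g ω) ∂Q = mgf (∑ i ∈ I, Y i) Q lam := by
          simp only [mgf, hsum]
      _ = ∏ i ∈ I, mgf (Y i) Q lam := h1
      _ ≤ ∏ _i ∈ I, Real.exp (lam ^ 2 * ∫ w, g w ^ 2 ∂P) :=
          Finset.prod_le_prod (fun _ _ => mgf_nonneg) fun i _ => h2 i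
      _ = _ := by
          rw [Finset.prod_const, ← Real.exp_nat_mul]
          congr 1
          ring

/-- Bernstein-type maximal inequality for a finite class. -/
theorem expectedSupLE_finite [IsProbabilityMeasure P] [IsProbabilityMeasure Q]
    (hW : ∀ i, MeasurePreserving (W i) Q P) (hind : iIndepFun W Q) (I : Finset ℕ)
    {κ : Type*} [Fintype κ] {g : κ → S → ℝ} (hg : ∀ q, Measurable (g q)) {t L : ℝ} (ht : 0 < t)
    (hgt : ∀ q w, |g q w| ≤ t) (hcard : 2 * (Fintype.card κ : ℝ) ≤ Real.exp L)
    (hg2 : ∀ q, I.card * ∫ w, g q w ^ 2 ∂P ≤ t ^ 2 * L) :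
    ExpectedSupLE Q (fun q => centredSum P W I (g q)) (5 / 2 * (t * L)) := by
  -- Since `|g - P g| ≤ 2 t`, this is the largest `lam` for which the exponents are guaranteed to
  -- stay in `[-1, 1]`; the exponential moment is then at most `exp (L / 4)`.
  set lam : ℝ := 1 / (2 * t) with hlam
  have hlam0 : 0 < lam := by positivity
  have hl1 : |lam| * (2 * t) ≤ 1 := by rw [abs_of_pos hlam0, hlam]; field_simp; rfl
  have hl2 : |-lam| * (2 * t) ≤ 1 := by rwa [abs_neg]
  -- `c = L + L / 4` bounds the logarithm of the sum of all exponential moments, over both signs and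
  -- all functions.
  set c : ℝ := 5 / 4 * L with hc
  have hE1 := fun q => integral_exp_centredSum_le hW hind I (hg q) hl1 (hgt q)
  have hE2 := fun q => integral_exp_centredSum_le hW hind I (hg q) hl2 (hgt q)
  have hb : ∀ q, Real.exp (lam ^ 2 * (I.card * ∫ w, g q w ^ 2 ∂P)) ≤ Real.exp (L / 4) :=
    fun q => by
      refine Real.exp_le_exp.2 ?_
      calc lam ^ 2 * (I.card * ∫ w, g q w ^ 2 ∂P) ≤ lam ^ 2 * (t ^ 2 * L) :=
            mul_le_mul_of_nonneg_left (hg2 q) (by positivity)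
        _ = L / 4 := by rw [hlam]; field_simp; ring
  let F : κ → Ω → ℝ := fun q ω => Real.exp (lam * centredSum P W I (g q) ω)
    + Real.exp (-lam * centredSum P W I (g q) ω)
  have hF : ∀ q, Integrable (F q) Q := fun q => (hE1 q).1.add (hE2 q).1
  have hFi : ∀ q, ∫ ω, F q ω ∂Q ≤ 2 * Real.exp (L / 4) := fun q => by
    simp only [F]
    rw [integral_add (hE1 q).1 (hE2 q).1]
    have h1 := (hE1 q).2.trans (hb q)
    have h2 := (hE2 q).2
    rw [neg_sq] at h2
    linarith [hb q]
  -- The majorant comes from `y ≤ c - 1 + exp (y - c)`, the tangent to the exponential at `c`, with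
  -- the maximum of the exponentials replaced by their sum. It is linear in the exponentials, so its
  -- expectation is at most `c / lam`.
  refine ⟨fun ω => 1 / lam * (c - 1 + Real.exp (-c) * ∑ q, F q ω),
    (((integrable_const _).add ((integrable_finsetSum _ fun q _ => hF q).const_mul _)).const_mul
      _), ae_of_all _ fun ω q => ?_, ?_⟩
  · have h1 : F q ω ≤ ∑ q, F q ω :=
      Finset.single_le_sum (f := fun q => F q ω) (fun q _ => by positivity) (Finset.mem_univ q)
    have h2 : Real.exp (lam * |centredSum P W I (g q) ω|) ≤ F q ω := by
      rcases abs_choice (centredSum P W I (g q) ω) with h | h <;> rw [h]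
      · exact le_add_of_nonneg_right (Real.exp_pos _).le
      · rw [mul_neg, ← neg_mul]
        exact le_add_of_nonneg_left (Real.exp_pos _).le
    have h3 := Real.add_one_le_exp (lam * |centredSum P W I (g q) ω| - c)
    rw [sub_eq_add_neg, Real.exp_add, mul_comm (Real.exp _)] at h3
    have h4 := mul_le_mul_of_nonneg_left (h2.trans h1) (Real.exp_pos (-c)).le
    beta_reduce
    rw [one_div, ← div_eq_inv_mul, le_div_iff₀ hlam0]
    linarith
  · rw [integral_const_mul, integral_add (integrable_const _)
      ((integrable_finsetSum _ fun q _ => hF q).const_mul _), integral_const_mul,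
      integral_finsetSum _ fun q _ => hF q]
    have h1 : ∑ q, ∫ ω, F q ω ∂Q ≤ Real.exp c := by
      calc ∑ q, ∫ ω, F q ω ∂Q ≤ ∑ _q : κ, 2 * Real.exp (L / 4) :=
            Finset.sum_le_sum fun q _ => hFi q
        _ = (2 * Fintype.card κ) * Real.exp (L / 4) := by
            simp [Finset.card_univ]; ring
        _ ≤ Real.exp L * Real.exp (L / 4) := mul_le_mul_of_nonneg_right hcard (Real.exp_pos _).le
        _ = Real.exp c := by rw [← Real.exp_add, hc]; congr 1; ring
    have h2 := mul_le_mul_of_nonneg_left h1 (Real.exp_pos (-c)).le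
    rw [← Real.exp_add, neg_add_cancel, Real.exp_zero] at h2
    have h3 : ∫ _ω : Ω, (c - 1) ∂Q = c - 1 := by simp
    rw [h3]
    calc 1 / lam * (c - 1 + Real.exp (-c) * ∑ q, ∫ ω, F q ω ∂Q) ≤ 1 / lam * c :=
          mul_le_mul_of_nonneg_left (by linarith) (by positivity)
      _ = _ := by rw [hlam, hc]; field_simp; ring

end Finite

/-! ### Chains of nested brackets -/

section Chain

variable {S : Type*}

/-- The lower ends of the nested brackets along the path `j`, starting from a bracket that is
clipped to `[-H, H]`. -/
def chainLower (l : ℕ → ℕ → S → ℝ) (H : S → ℝ) (j : ℕ → ℕ) : ℕ → S → ℝ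
  | 0, w => max (-H w) (min (l 0 (j 0) w) (H w))
  | k + 1, w => max (chainLower l H j k w) (l (k + 1) (j (k + 1)) w)

/-- The upper ends of the nested brackets along the path `j`. -/
def chainUpper (u : ℕ → ℕ → S → ℝ) (H : S → ℝ) (j : ℕ → ℕ) : ℕ → S → ℝ
  | 0, w => min (u 0 (j 0) w) (H w)
  | k + 1, w => min (chainUpper u H j k w) (u (k + 1) (j (k + 1)) w)

/-- The widths of the nested brackets along the path `j`. -/
def chainGap (l u : ℕ → ℕ → S → ℝ) (H : S → ℝ) (j : ℕ → ℕ) (k : ℕ) (w : S) : ℝ :=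
  max (chainUpper u H j k w - chainLower l H j k w) 0

/-- The widths do not exceed the truncation levels `t` up to level `k`. -/
def ChainActive (l u : ℕ → ℕ → S → ℝ) (H : S → ℝ) (t : ℕ → ℝ) (j : ℕ → ℕ) (k : ℕ) (w : S) :
    Prop :=
  ∀ i ≤ k, chainGap l u H j i w ≤ t i

open Classical in
/-- The truncated starting point of the chain. -/
def chainStart (l : ℕ → ℕ → S → ℝ) (H : S → ℝ) (t : ℕ → ℝ) (j : ℕ → ℕ) (w : S) : ℝ :=
  if |chainLower l H j 0 w| ≤ t 0 then chainLower l H j 0 w else 0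

open Classical in
/-- The links of the chain. -/
def chainLink (l u : ℕ → ℕ → S → ℝ) (H : S → ℝ) (t : ℕ → ℝ) (j : ℕ → ℕ) (k : ℕ) (w : S) : ℝ :=
  if ChainActive l u H t j k w then
    min (chainLower l H j (k + 1) w - chainLower l H j k w) (chainGap l u H j k w) else 0

open Classical in
/-- The width at the level at which the truncation level is first exceeded. -/
def chainExit (l u : ℕ → ℕ → S → ℝ) (H : S → ℝ) (t : ℕ → ℝ) (j : ℕ → ℕ) (k : ℕ) (w : S) : ℝ :=
  if ChainActive l u H t j k w ∧ t (k + 1) < chainGap l u H j (k + 1) w then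
    chainGap l u H j (k + 1) w else 0

open Classical in
/-- The width at the end of the chain. -/
def chainFinal (l u : ℕ → ℕ → S → ℝ) (H : S → ℝ) (t : ℕ → ℝ) (j : ℕ → ℕ) (k : ℕ) (w : S) : ℝ :=
  if ChainActive l u H t j k w then chainGap l u H j k w else 0

/-- The tail `H 1(2 H > t)` of an envelope. -/
def envelopeTail (H : S → ℝ) (t : ℝ) (w : S) : ℝ := if t < 2 * H w then H w else 0

variable {l u : ℕ → ℕ → S → ℝ} {H : S → ℝ} {t : ℕ → ℝ} {j j' : ℕ → ℕ} {k : ℕ} {w : S}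

/-- The chain at level `k` sees only the first `k + 1` indices of the path. This and the analogues
below reduce suprema over the class to maxima over finitely many paths. -/
theorem chainLower_congr (h : ∀ i < k + 1, j i = j' i) :
    chainLower l H j k = chainLower l H j' k := by
  induction k with
  | zero => ext w; simp [chainLower, h 0 (by omega)]
  | succ k ih =>
    ext w
    simp [chainLower, h (k + 1) (by omega), ih fun i hi => h i (by omega)]

theorem chainUpper_congr (h : ∀ i < k + 1, j i = j' i) :
    chainUpper u H j k = chainUpper u H j' k := by
  induction k with
  | zero => ext w; simp [chainUpper, h 0 (by omega)]
  | succ k ih =>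
    ext w
    simp [chainUpper, h (k + 1) (by omega), ih fun i hi => h i (by omega)]

theorem chainGap_congr (h : ∀ i < k + 1, j i = j' i) :
    chainGap l u H j k = chainGap l u H j' k := by
  ext w
  simp only [chainGap, chainLower_congr h, chainUpper_congr h]

theorem chainActive_congr (h : ∀ i < k + 1, j i = j' i) :
    ChainActive l u H t j k = ChainActive l u H t j' k := by
  ext w
  refine forall₂_congr fun i hi => ?_
  rw [chainGap_congr fun m hm => h m (by omega)]

theorem chainLink_congr (h : ∀ i < k + 2, j i = j' i) :
    chainLink l u H t j k = chainLink l u H t j' k := by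
  ext w
  have h' : ∀ i < k + 1, j i = j' i := fun i hi => h i (by omega)
  rw [chainLink, chainLink, chainActive_congr h', chainGap_congr h', chainLower_congr h',
    chainLower_congr (k := k + 1) h]

theorem chainExit_congr (h : ∀ i < k + 2, j i = j' i) :
    chainExit l u H t j k = chainExit l u H t j' k := by
  ext w
  have h' : ∀ i < k + 1, j i = j' i := fun i hi => h i (by omega)
  rw [chainExit, chainExit, chainActive_congr h', chainGap_congr (k := k + 1) h]

theorem chainFinal_congr (h : ∀ i < k + 1, j i = j' i) :
    chainFinal l u H t j k = chainFinal l u H t j' k := by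
  ext w
  rw [chainFinal, chainFinal, chainActive_congr h, chainGap_congr h]

theorem chainStart_congr (h : ∀ i < 1, j i = j' i) :
    chainStart l H t j = chainStart l H t j' := by
  ext w
  simp only [chainStart, chainLower_congr (k := 0) h]

theorem chainLower_mono : chainLower l H j k w ≤ chainLower l H j (k + 1) w := le_max_left _ _

theorem chainGap_nonneg : 0 ≤ chainGap l u H j k w := le_max_right _ _

theorem chainGap_anti : chainGap l u H j (k + 1) w ≤ chainGap l u H j k w :=
  max_le_max_right _ (sub_le_sub (min_le_left _ _) (le_max_left _ _))

theorem chainGap_le : chainGap l u H j k w ≤ |u k (j k) w - l k (j k) w| := by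
  refine max_le ?_ (abs_nonneg _)
  cases k with
  | zero =>
    have h1 : min (u 0 (j 0) w) (H w) - min (l 0 (j 0) w) (H w)
        ≤ |u 0 (j 0) w - l 0 (j 0) w| := by
      refine (le_abs_self _).trans ((abs_min_sub_min_le_max _ _ _ _).trans ?_)
      simp
    exact (sub_le_sub_left (le_max_right _ _) _).trans h1
  | succ k =>
    exact (sub_le_sub (min_le_right _ _) (le_max_right _ _)).trans (le_abs_self _)

theorem chainGap_zero_le (hH : 0 ≤ H w) : chainGap l u H j 0 w ≤ 2 * H w := by
  have h1 : chainUpper u H j 0 w ≤ H w := min_le_right _ _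
  have h2 : -H w ≤ chainLower l H j 0 w := le_max_left _ _
  exact max_le (by linarith) (by linarith)

theorem abs_chainLower_zero_le (hH : 0 ≤ H w) : |chainLower l H j 0 w| ≤ H w :=
  abs_le.2 ⟨le_max_left _ _, max_le (by linarith) (min_le_right _ _)⟩

/-- Clipping to a symmetric interval does not increase the modulus, so the second moment of the
lower bracket function bounds that of the starting point. -/
theorem abs_chainLower_zero_le' (hH : 0 ≤ H w) : |chainLower l H j 0 w| ≤ |l 0 (j 0) w| := by
  refine abs_le.2 ⟨?_, max_le (by linarith [abs_nonneg (l 0 (j 0) w)]) ?_⟩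
  · rcases le_total (l 0 (j 0) w) (H w) with h | h
    · refine le_trans (neg_abs_le _) (le_trans ?_ (le_max_right _ _))
      rw [min_eq_left h]
    · refine le_trans ?_ (le_max_right _ _)
      rw [min_eq_right h]
      linarith [abs_nonneg (l 0 (j 0) w)]
  · exact (min_le_left _ _).trans (le_abs_self _)

theorem chain_sandwich {x : ℝ} (hx : |x| ≤ H w)
    (hlu : ∀ k, l k (j k) w ≤ x ∧ x ≤ u k (j k) w) (k : ℕ) :
    chainLower l H j k w ≤ x ∧ x ≤ chainUpper u H j k w := by
  obtain ⟨h1, h2⟩ := abs_le.1 hx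
  induction k with
  | zero => exact ⟨max_le h1 ((min_le_left _ _).trans (hlu 0).1), le_min (hlu 0).2 h2⟩
  | succ k ih => exact ⟨max_le ih.1 (hlu _).1, le_min ih.2 (hlu _).2⟩

theorem ChainActive.of_succ (h : ChainActive l u H t j (k + 1) w) : ChainActive l u H t j k w :=
  fun i hi => h i (by omega)

theorem ChainActive.le (h : ChainActive l u H t j k w) : chainGap l u H j k w ≤ t k :=
  h k le_rfl

theorem chainExit_nonneg : 0 ≤ chainExit l u H t j k w := by
  unfold chainExit; split_ifs
  exacts [chainGap_nonneg, le_rfl]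

theorem chainFinal_nonneg : 0 ≤ chainFinal l u H t j k w := by
  unfold chainFinal; split_ifs
  exacts [chainGap_nonneg, le_rfl]

theorem chainLink_nonneg : 0 ≤ chainLink l u H t j k w := by
  unfold chainLink; split_ifs
  exacts [le_min (sub_nonneg.2 chainLower_mono) chainGap_nonneg, le_rfl]

theorem chainFinal_le_gap : chainFinal l u H t j k w ≤ chainGap l u H j k w := by
  unfold chainFinal; split_ifs
  exacts [le_rfl, chainGap_nonneg]

/-- This is what the minimum in `chainLink` is for: the bound holds on every path, also where the
brackets along it are incompatible and the increment of the lower ends could exceed the width. -/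
theorem chainLink_le_final : chainLink l u H t j k w ≤ chainFinal l u H t j k w := by
  unfold chainLink chainFinal; split_ifs
  exacts [min_le_right _ _, le_rfl]

theorem chainFinal_le (ht : 0 ≤ t k) : chainFinal l u H t j k w ≤ t k := by
  unfold chainFinal
  split_ifs with h
  exacts [h.le, ht]

theorem chainExit_le_gap : chainExit l u H t j k w ≤ chainGap l u H j (k + 1) w := by
  unfold chainExit; split_ifs
  exacts [le_rfl, chainGap_nonneg]

/-- The width at the exit level exceeds its own truncation level, but widths decrease and the chain
was still active one level earlier. -/
theorem chainExit_le (ht : 0 ≤ t k) : chainExit l u H t j k w ≤ t k := by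
  unfold chainExit
  split_ifs with h
  exacts [chainGap_anti.trans h.1.le, ht]

/-- At an exit the width divided by the truncation level is greater than one. This gains a second
moment, which makes the mean of the exit small. -/
theorem chainExit_le_sq (ht : 0 < t (k + 1)) :
    chainExit l u H t j k w ≤ chainGap l u H j (k + 1) w ^ 2 / t (k + 1) := by
  unfold chainExit
  split_ifs with h
  · rw [le_div_iff₀ ht, sq]
    exact mul_le_mul_of_nonneg_left h.2.le chainGap_nonneg
  · positivity

theorem envelopeTail_nonneg (hH : 0 ≤ H w) (c : ℝ) : 0 ≤ envelopeTail H c w := by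
  unfold envelopeTail; split_ifs
  exacts [hH, le_rfl]

theorem envelopeTail_le (hH : 0 ≤ H w) (c : ℝ) : envelopeTail H c w ≤ H w := by
  unfold envelopeTail; split_ifs
  exacts [le_rfl, hH]

/-- The chaining decomposition at a sample point. -/
theorem abs_sub_chain_le {x : ℝ} (hH : 0 ≤ H w) (hx : |x| ≤ H w)
    (hlu : ∀ k, l k (j k) w ≤ x ∧ x ≤ u k (j k) w) (K : ℕ) :
    |x - (chainStart l H t j w + ∑ k ∈ Finset.range K, chainLink l u H t j k w)|
      ≤ 3 * envelopeTail H (t 0) w + (∑ k ∈ Finset.range K, chainExit l u H t j k w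
        + chainFinal l u H t j K w) := by
  have hs := chain_sandwich hx hlu
  have hgap : ∀ k, chainUpper u H j k w - chainLower l H j k w = chainGap l u H j k w :=
    fun k => (max_eq_left (by linarith [(hs k).1, (hs k).2])).symm
  have hxg : ∀ k, |x - chainLower l H j k w| ≤ chainGap l u H j k w := fun k => by
    rw [← hgap, abs_of_nonneg (by linarith [(hs k).1])]
    linarith [(hs k).2]
  -- While the chain is active the links telescope: both nested brackets contain `x`, so the minimum
  -- in each link is the increment of the lower ends. After an exit all links vanish and the error
  -- stays below the width at the exit level. An exit at level `0` forces `t 0 < 2 H`, as the first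
  -- width is at most `2 H`.
  have key : ∀ K, (ChainActive l u H t j K w →
      x - chainLower l H j 0 w - ∑ k ∈ Finset.range K, chainLink l u H t j k w
        = x - chainLower l H j K w) ∧
      (¬ ChainActive l u H t j K w →
        |x - chainLower l H j 0 w - ∑ k ∈ Finset.range K, chainLink l u H t j k w|
        ≤ 2 * envelopeTail H (t 0) w + ∑ k ∈ Finset.range K, chainExit l u H t j k w) := by
    intro K
    induction K with
    | zero =>
      refine ⟨fun _ => by simp, fun h => ?_⟩
      have h0 : t 0 < chainGap l u H j 0 w := by
        by_contra! h0
        refine h fun i hi => ?_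
        rwa [Nat.le_zero.1 hi]
      have h1 := chainGap_zero_le (l := l) (u := u) (j := j) hH
      have h2 : envelopeTail H (t 0) w = H w := if_pos (h0.trans_le h1)
      simp only [Finset.range_zero, Finset.sum_empty, sub_zero, add_zero, h2]
      exact (hxg 0).trans h1
    | succ K ih =>
      simp only [Finset.sum_range_succ, ← sub_sub, ← add_assoc]
      by_cases hK : ChainActive l u H t j K w
      · have hl : chainLink l u H t j K w
            = chainLower l H j (K + 1) w - chainLower l H j K w := by
          unfold chainLink
          rw [if_pos hK, min_eq_left]
          rw [← hgap]
          linarith [(hs (K + 1)).1, (hs K).2]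
        rw [ih.1 hK, hl]
        refine ⟨fun _ => by ring, fun h => ?_⟩
        have h0 : t (K + 1) < chainGap l u H j (K + 1) w := by
          by_contra! h0
          refine h fun i hi => ?_
          rcases Nat.le_succ_iff.1 hi with hi | rfl
          exacts [hK i hi, h0]
        have he : chainExit l u H t j K w = chainGap l u H j (K + 1) w := if_pos ⟨hK, h0⟩
        have h2 : 0 ≤ ∑ k ∈ Finset.range K, chainExit l u H t j k w :=
          Finset.sum_nonneg fun _ _ => chainExit_nonneg
        rw [he, sub_sub_sub_cancel_right]
        linarith [hxg (K + 1), envelopeTail_nonneg hH (t 0)]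
      · refine ⟨fun h => absurd h.of_succ hK, fun _ => ?_⟩
        have hl : chainLink l u H t j K w = 0 := if_neg hK
        rw [hl, sub_zero]
        exact (ih.2 hK).trans (le_add_of_nonneg_right chainExit_nonneg)
  have hstart : |chainLower l H j 0 w - chainStart l H t j w| ≤ envelopeTail H (t 0) w := by
    have h0 := abs_chainLower_zero_le (l := l) (j := j) hH
    unfold chainStart
    split_ifs with h
    · simpa using envelopeTail_nonneg hH (t 0)
    · rw [sub_zero, envelopeTail, if_pos (by linarith [not_le.1 h])]
      exact h0
  have hE : 0 ≤ ∑ k ∈ Finset.range K, chainExit l u H t j k w :=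
    Finset.sum_nonneg fun _ _ => chainExit_nonneg
  have hmain : |x - chainLower l H j 0 w - ∑ k ∈ Finset.range K, chainLink l u H t j k w|
      ≤ 2 * envelopeTail H (t 0) w + (∑ k ∈ Finset.range K, chainExit l u H t j k w
        + chainFinal l u H t j K w) := by
    by_cases hK : ChainActive l u H t j K w
    · rw [(key K).1 hK]
      have : chainFinal l u H t j K w = chainGap l u H j K w := if_pos hK
      linarith [hxg K, envelopeTail_nonneg hH (t 0)]
    · linarith [(key K).2 hK, chainFinal_nonneg (l := l) (u := u) (H := H) (t := t) (j := j)
        (k := K) (w := w)]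
  calc _ = |(x - chainLower l H j 0 w - ∑ k ∈ Finset.range K, chainLink l u H t j k w)
          + (chainLower l H j 0 w - chainStart l H t j w)| := by congr 1; ring
    _ ≤ _ := (abs_add_le _ _).trans (by linarith)

variable [MeasurableSpace S]

theorem measurable_chainLower (hl : ∀ k j, Measurable (l k j)) (hH : Measurable H) (j : ℕ → ℕ)
    (k : ℕ) : Measurable (chainLower l H j k) := by
  induction k with
  | zero => exact hH.neg.max ((hl _ _).min hH)
  | succ k ih => exact ih.max (hl _ _)

theorem measurable_chainUpper (hu : ∀ k j, Measurable (u k j)) (hH : Measurable H) (j : ℕ → ℕ)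
    (k : ℕ) : Measurable (chainUpper u H j k) := by
  induction k with
  | zero => exact (hu _ _).min hH
  | succ k ih => exact ih.min (hu _ _)

theorem measurable_chainGap (hl : ∀ k j, Measurable (l k j)) (hu : ∀ k j, Measurable (u k j))
    (hH : Measurable H) (j : ℕ → ℕ) (k : ℕ) : Measurable (chainGap l u H j k) :=
  ((measurable_chainUpper hu hH j k).sub (measurable_chainLower hl hH j k)).max measurable_const

theorem measurableSet_chainActive (hl : ∀ k j, Measurable (l k j))
    (hu : ∀ k j, Measurable (u k j)) (hH : Measurable H) (t : ℕ → ℝ) (j : ℕ → ℕ) (k : ℕ) :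
    MeasurableSet {w | ChainActive l u H t j k w} := by
  simp only [ChainActive, ofPred_forall]
  exact MeasurableSet.iInter fun i => MeasurableSet.iInter fun _ =>
    measurableSet_le (measurable_chainGap hl hu hH j i) measurable_const

theorem measurable_chainStart (hl : ∀ k j, Measurable (l k j)) (hH : Measurable H) (t : ℕ → ℝ)
    (j : ℕ → ℕ) : Measurable (chainStart l H t j) := by
  have h := measurable_chainLower hl hH j 0
  exact Measurable.ite (measurableSet_le h.abs measurable_const) h measurable_const

theorem measurable_chainLink (hl : ∀ k j, Measurable (l k j)) (hu : ∀ k j, Measurable (u k j))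
    (hH : Measurable H) (t : ℕ → ℝ) (j : ℕ → ℕ) (k : ℕ) :
    Measurable (chainLink l u H t j k) :=
  Measurable.ite (measurableSet_chainActive hl hu hH t j k)
    (((measurable_chainLower hl hH j _).sub (measurable_chainLower hl hH j _)).min
      (measurable_chainGap hl hu hH j k)) measurable_const

theorem measurable_chainExit (hl : ∀ k j, Measurable (l k j)) (hu : ∀ k j, Measurable (u k j))
    (hH : Measurable H) (t : ℕ → ℝ) (j : ℕ → ℕ) (k : ℕ) :
    Measurable (chainExit l u H t j k) :=
  Measurable.ite ((measurableSet_chainActive hl hu hH t j k).inter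
    (measurableSet_lt measurable_const (measurable_chainGap hl hu hH j (k + 1))))
    (measurable_chainGap hl hu hH j (k + 1)) measurable_const

theorem measurable_chainFinal (hl : ∀ k j, Measurable (l k j)) (hu : ∀ k j, Measurable (u k j))
    (hH : Measurable H) (t : ℕ → ℝ) (j : ℕ → ℕ) (k : ℕ) :
    Measurable (chainFinal l u H t j k) :=
  Measurable.ite (measurableSet_chainActive hl hu hH t j k)
    (measurable_chainGap hl hu hH j k) measurable_const

theorem measurable_envelopeTail (hH : Measurable H) (c : ℝ) : Measurable (envelopeTail H c) :=
  Measurable.ite (measurableSet_lt measurable_const (hH.const_mul 2)) hH measurable_const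

end Chain

/-! ### The bracketing maximal inequality -/

section Chaining

variable {S Ω : Type*} [MeasurableSpace S] [MeasurableSpace Ω] {P : Measure S}
  {Q : Measure Ω} {W : ℕ → Ω → S}

/-- The paths below level `m` form a finite set with `∏_{i < m} N i` elements. -/
theorem exists_path_net (N : ℕ → ℕ) (m : ℕ) : ∃ (κ : Type) (_ : Fintype κ) (e : κ → ℕ → ℕ),
    Fintype.card κ = ∏ i ∈ Finset.range m, N i ∧
    ∀ j : ℕ → ℕ, (∀ i, j i < N i) → ∃ q, ∀ i < m, j i = e q i := by
  refine ⟨∀ i : Fin m, Fin (N i), inferInstance,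
    -- The value `0` beyond level `m` is arbitrary; only the indices below `m` are compared.
    fun q i => if h : i < m then q ⟨i, h⟩ else 0, ?_, fun j hj => ⟨fun i => ⟨j i, hj i⟩, ?_⟩⟩
  · rw [Fintype.card_pi, Finset.prod_range]
    simp
  · intro i hi
    simp [hi]

/-- The finite maximal inequality for functions that depend on a path up to level `m`. -/
theorem expectedSupLE_path [IsProbabilityMeasure P] [IsProbabilityMeasure Q]
    (hW : ∀ i, MeasurePreserving (W i) Q P) (hind : iIndepFun W Q) (I : Finset ℕ)
    {N : ℕ → ℕ} {ι : Type*} {path : ι → ℕ → ℕ} (hpath : ∀ i k, path i k < N k) (m : ℕ)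
    {g : (ℕ → ℕ) → S → ℝ} (hg : ∀ j, Measurable (g j))
    (hgm : ∀ j j', (∀ i < m, j i = j' i) → g j = g j') {t L : ℝ} (ht : 0 < t)
    (hg0 : ∀ j w, |g j w| ≤ t)
    (hcard : 2 * ((∏ i ∈ Finset.range m, N i : ℕ) : ℝ) ≤ Real.exp L)
    (hg2 : ∀ j, I.card * ∫ w, g j w ^ 2 ∂P ≤ t ^ 2 * L) :
    ExpectedSupLE Q (fun i => centredSum P W I (g (path i))) (5 / 2 * (t * L)) := by
  obtain ⟨κ, _, e, hc, he⟩ := exists_path_net N m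
  choose q hq using fun i => he (path i) (hpath i)
  have h := (expectedSupLE_finite hW hind I (g := fun a => g (e a)) (fun a => hg _) ht
    (fun a w => hg0 _ w) (by rwa [hc]) fun a => hg2 _).reindex q
  have h2 : ∀ i, g (path i) = g (e (q i)) := fun i => hgm _ _ (hq i)
  simpa only [h2] using h

/-- The exponents add up to `L (1 + ⋯ + (m + 1)) ≤ L (m + 1)²`; only one of the factors `2` is kept.
-/
theorem prod_card_le_exp {N : ℕ → ℕ} {L : ℝ} (hL : 0 ≤ L)
    (hN : ∀ k, 2 * (N k : ℝ) ≤ Real.exp (L * (k + 1))) (m : ℕ) :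
    2 * ((∏ i ∈ Finset.range (m + 1), N i : ℕ) : ℝ) ≤ Real.exp (L * (m + 1) ^ 2) := by
  induction m with
  | zero => simpa using hN 0
  | succ m ih =>
    rw [Finset.prod_range_succ]
    push_cast at ih ⊢
    have h1 : (N (m + 1) : ℝ) ≤ Real.exp (L * (m + 1 + 1)) := by
      have := hN (m + 1)
      push_cast at this
      have h0 : (0 : ℝ) ≤ N (m + 1) := by positivity
      linarith
    calc 2 * ((∏ i ∈ Finset.range (m + 1), (N i : ℝ)) * (N (m + 1) : ℝ))
        = (2 * ∏ i ∈ Finset.range (m + 1), (N i : ℝ)) * (N (m + 1) : ℝ) := by ring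
      _ ≤ Real.exp (L * (m + 1) ^ 2) * Real.exp (L * (m + 1 + 1)) :=
          mul_le_mul ih h1 (by positivity) (Real.exp_pos _).le
      _ ≤ Real.exp (L * (m + 1 + 1) ^ 2) := by
          rw [← Real.exp_add]
          refine Real.exp_le_exp.2 ?_
          have : (0 : ℝ) ≤ m := by positivity
          nlinarith

theorem sum_add_two_div_two_pow_le (K : ℕ) :
    ∑ k ∈ Finset.range K, ((k : ℝ) + 2) / 2 ^ k ≤ 6 := by
  have h : ∀ K : ℕ, ∑ k ∈ Finset.range K, ((k : ℝ) + 2) / 2 ^ k = 6 - 2 * (K + 3) / 2 ^ K := by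
    intro K
    induction K with
    | zero => norm_num
    | succ K ih =>
      rw [Finset.sum_range_succ, ih]
      push_cast
      field_simp
      ring
  rw [h]
  have : (0 : ℝ) ≤ 2 * (K + 3) / 2 ^ K := by positivity
  linarith

/-- The pointwise bound `|g| ≤ (g² + c²) / (2 c)` yields integrability together with the
Cauchy–Schwarz bound. -/
theorem integral_le_of_sq [IsProbabilityMeasure P] {g : S → ℝ} (hg : Measurable g)
    (hg2 : Integrable (fun w => g w ^ 2) P) {c : ℝ} (hc : 0 < c)
    (h : ∫ w, g w ^ 2 ∂P ≤ c ^ 2) : Integrable g P ∧ ∫ w, g w ∂P ≤ c := by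
  have hpt : ∀ w, |g w| ≤ (2 * c)⁻¹ * (g w ^ 2 + c ^ 2) := fun w => by
    rw [← div_eq_inv_mul, le_div_iff₀ (by positivity)]
    nlinarith [sq_nonneg (|g w| - c), sq_abs (g w)]
  have hi : Integrable (fun w => (2 * c)⁻¹ * (g w ^ 2 + c ^ 2)) P :=
    (hg2.add (integrable_const _)).const_mul _
  have hgi : Integrable g P := hi.mono' hg.aestronglyMeasurable (ae_of_all _ hpt)
  refine ⟨hgi, (integral_mono hgi hi fun w => (le_abs_self _).trans (hpt w)).trans ?_⟩
  rw [integral_const_mul, integral_add hg2 (integrable_const _)]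
  simp only [integral_const, probReal_univ, one_smul]
  calc (2 * c)⁻¹ * (∫ w, g w ^ 2 ∂P + c ^ 2) ≤ (2 * c)⁻¹ * (c ^ 2 + c ^ 2) := by gcongr
    _ = c := by field_simp; ring

/-- Bracketing maximal inequality: if the class has brackets of `L₂`-size `σ 2⁻ᵏ` whose number
grows at most like `exp (L (k + 1))`, then the expected supremum of the centred sums over a sample
of size `n` is of the order of `√n σ √L`, up to a term for the tail of the envelope. -/
theorem expectedSupLE_bracketing [IsProbabilityMeasure P] [IsProbabilityMeasure Q]
    (hW : ∀ i, MeasurePreserving (W i) Q P) (hind : iIndepFun W Q) {I : Finset ℕ}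
    (hI : I.Nonempty) {ι : Type*} {F : ι → S → ℝ} (hF : ∀ i, AEStronglyMeasurable (F i) P)
    {H : S → ℝ} (hH : Measurable H) (hHi : Integrable H P) (hH0 : ∀ w, 0 ≤ H w)
    {N : ℕ → ℕ} {l u : ℕ → ℕ → S → ℝ} (hl : ∀ k j, Measurable (l k j))
    (hu : ∀ k j, Measurable (u k j)) {σ L : ℝ} (hσ : 0 < σ) (hL : 1 ≤ L)
    (hN : ∀ k, 2 * (N k : ℝ) ≤ Real.exp (L * (k + 1)))
    (hul : ∀ k j, Integrable (fun w => (u k j w - l k j w) ^ 2) P)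
    (hul2 : ∀ k j, ∫ w, (u k j w - l k j w) ^ 2 ∂P ≤ (σ / 2 ^ k) ^ 2)
    (hl0 : ∀ j, Integrable (fun w => l 0 j w ^ 2) P)
    (hl02 : ∀ j, ∫ w, l 0 j w ^ 2 ∂P ≤ (2 * σ) ^ 2)
    {path : ι → ℕ → ℕ} (hpath : ∀ i k, path i k < N k)
    (hcov : ∀ᵐ w ∂P, ∀ i, |F i w| ≤ H w ∧
      ∀ k, l k (path i k) w ≤ F i w ∧ F i w ≤ u k (path i k) w) :
    ExpectedSupLE Q (fun i => centredSum P W I (F i))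
      (88 * (√I.card * σ * √L)
        + 6 * (I.card * ∫ w, envelopeTail H (√I.card * σ / √L) w ∂P)) := by
  set n : ℝ := (I.card : ℝ) with hn
  have hn0 : 0 < n := by rw [hn]; exact_mod_cast hI.card_pos
  have hL0 : 0 < L := by linarith
  -- The levels balance variance and entropy: `t k ^ 2 * (L (k + 2)²) = 4 n (σ / 2ᵏ)²`, where `L (k
  -- + 2)²` bounds the log-cardinality of the paths used at level `k`. The factor `2` leaves room
  -- for the starting point, whose norm may be `2 σ`.
  set t : ℕ → ℝ := fun k => 2 * √n * σ / 2 ^ k / (√L * (k + 2)) with ht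
  have ht0 : ∀ k, 0 < t k := fun k => by simp only [ht]; positivity
  have htz : t 0 = √n * σ / √L := by simp only [ht]; field_simp; simp
  have hnn : √n * √n = n := Real.mul_self_sqrt hn0.le
  have hLL : √L * √L = L := Real.mul_self_sqrt hL0.le
  have hsL : 1 ≤ √L := Real.one_le_sqrt.2 hL
  have hsn : 0 < √n := Real.sqrt_pos.2 hn0
  have htL : ∀ k : ℕ, t k * (L * (k + 2) ^ 2) = 2 * (√n * σ * √L) * ((k + 2) / 2 ^ k) :=
    fun k => by
      simp only [ht]
      rw [← hLL]
      simp only [Real.sqrt_mul_self (Real.sqrt_nonneg L)]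
      field_simp
  have ht2L : ∀ k : ℕ, t k ^ 2 * (L * (k + 2) ^ 2) = 4 * (n * (σ / 2 ^ k) ^ 2) := fun k => by
    simp only [ht, div_pow, mul_pow, Real.sq_sqrt hn0.le, Real.sq_sqrt hL0.le]
    field_simp
    norm_num
  -- the second moments of the widths
  have hgm := fun j k => measurable_chainGap hl hu hH j k
  have hgle : ∀ j k w, chainGap l u H j k w ^ 2 ≤ (u k (j k) w - l k (j k) w) ^ 2 :=
    fun j k w => by
      rw [← sq_abs (u k (j k) w - l k (j k) w)]
      exact pow_le_pow_left₀ chainGap_nonneg chainGap_le 2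
  have hgi2 : ∀ j k, Integrable (fun w => chainGap l u H j k w ^ 2) P := fun j k =>
    (hul k (j k)).mono' ((hgm j k).pow_const 2).aestronglyMeasurable (ae_of_all _ fun w => by
      rw [Real.norm_eq_abs, abs_of_nonneg (sq_nonneg _)]
      exact hgle j k w)
  have hg2 : ∀ j k, ∫ w, chainGap l u H j k w ^ 2 ∂P ≤ (σ / 2 ^ k) ^ 2 := fun j k =>
    (integral_mono (hgi2 j k) (hul k (j k)) fun w => hgle j k w).trans (hul2 _ _)
  have hsmall : ∀ (g : S → ℝ) (j : ℕ → ℕ) (k : ℕ), (∀ w, 0 ≤ g w) →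
      (∀ w, g w ≤ chainGap l u H j k w) → ∫ w, g w ^ 2 ∂P ≤ (σ / 2 ^ k) ^ 2 :=
    fun g j k h0 h1 => (integral_mono_of_nonneg (ae_of_all _ fun w => sq_nonneg _) (hgi2 j k)
      (ae_of_all _ fun w => pow_le_pow_left₀ (h0 w) (h1 w) 2)).trans (hg2 j k)
  have hbd : ∀ k : ℕ, ∀ x : ℝ, x ≤ (σ / 2 ^ k) ^ 2 → n * x ≤ t k ^ 2 * (L * (k + 2) ^ 2) :=
    fun k x hx => by
      rw [ht2L]
      nlinarith [mul_le_mul_of_nonneg_left hx hn0.le, mul_nonneg hn0.le (sq_nonneg (σ / 2 ^ k))]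
  have hcard := prod_card_le_exp hL0.le hN
  have hcard2 : ∀ k : ℕ, 2 * ((∏ i ∈ Finset.range (k + 2), N i : ℕ) : ℝ)
      ≤ Real.exp (L * (k + 2) ^ 2) := fun k => by
    refine (hcard (k + 1)).trans (le_of_eq ?_)
    push_cast
    ring_nf
  have hcard1 : ∀ k : ℕ, 2 * ((∏ i ∈ Finset.range (k + 1), N i : ℕ) : ℝ)
      ≤ Real.exp (L * (k + 2) ^ 2) := fun k => by
    refine (hcard k).trans (Real.exp_le_exp.2 (mul_le_mul_of_nonneg_left ?_ hL0.le))
    have : (0 : ℝ) ≤ k := by positivity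
    nlinarith
  -- the starting point
  have hstart : ExpectedSupLE Q (fun i => centredSum P W I (chainStart l H t (path i)))
      (10 * (√n * σ * √L)) := by
    refine (expectedSupLE_path hW hind I hpath 1 (t := t 0) (L := L * ((0 : ℕ) + 2) ^ 2)
      (g := fun j => chainStart l H t j) (fun j => measurable_chainStart hl hH t j)
      (fun j j' h => chainStart_congr h) (ht0 0) (fun j w => ?_) (hcard1 0) fun j => ?_).mono
      (le_of_eq ?_)
    · unfold chainStart
      split_ifs with h
      · exact h
      · simpa using (ht0 0).le
    · rw [ht2L]
      have h1 : ∫ w, chainStart l H t j w ^ 2 ∂P ≤ (2 * σ) ^ 2 := by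
        refine (integral_mono_of_nonneg (ae_of_all _ fun w => sq_nonneg _) (hl0 (j 0))
          (ae_of_all _ fun w => ?_)).trans (hl02 _)
        refine sq_le_sq.2 ?_
        unfold chainStart
        split_ifs
        · exact abs_chainLower_zero_le' (hH0 w)
        · simp
      have h2 := mul_le_mul_of_nonneg_left h1 hn0.le
      rw [← hn]
      refine h2.trans (le_of_eq ?_)
      norm_num
      ring
    · rw [htL]
      norm_num
      ring
  -- the links
  have hlink : ∀ k, ExpectedSupLE Q (fun i => centredSum P W I (chainLink l u H t (path i) k))
      (5 * (√n * σ * √L) * ((k + 2) / 2 ^ k)) := fun k => by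
    refine (expectedSupLE_path hW hind I hpath (k + 2) (t := t k) (L := L * (k + 2) ^ 2)
      (g := fun j => chainLink l u H t j k) (fun j => measurable_chainLink hl hu hH t j k)
      (fun j j' h => chainLink_congr h) (ht0 k) (fun j w => ?_) (hcard2 k) fun j => ?_).mono
      (le_of_eq ?_)
    · rw [abs_of_nonneg chainLink_nonneg]
      exact chainLink_le_final.trans (chainFinal_le (ht0 k).le)
    · exact hbd k _ (hsmall _ j k (fun w => chainLink_nonneg)
        fun w => chainLink_le_final.trans chainFinal_le_gap)
    · rw [htL]
      ring
  -- the exits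
  have hexit : ∀ k, ExpectedSupLE Q (fun i => centredSum P W I (chainExit l u H t (path i) k))
      (5 * (√n * σ * √L) * ((k + 2) / 2 ^ k)) := fun k => by
    refine (expectedSupLE_path hW hind I hpath (k + 2) (t := t k) (L := L * (k + 2) ^ 2)
      (g := fun j => chainExit l u H t j k) (fun j => measurable_chainExit hl hu hH t j k)
      (fun j j' h => chainExit_congr h) (ht0 k) (fun j w => ?_) (hcard2 k) fun j => ?_).mono
      (le_of_eq ?_)
    · rw [abs_of_nonneg chainExit_nonneg]
      exact chainExit_le (ht0 k).le
    · exact hbd k _ ((hsmall _ j (k + 1) (fun w => chainExit_nonneg)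
        fun w => chainExit_le_gap).trans (pow_le_pow_left₀ (by positivity)
        (div_le_div_of_nonneg_left hσ.le (by positivity)
          (pow_le_pow_right₀ (by norm_num) (Nat.le_succ k))) 2))
    · rw [htL]
      ring
  have hexiti : ∀ j k, Integrable (chainExit l u H t j k) P := fun j k =>
    Integrable.of_bound (measurable_chainExit hl hu hH t j k).aestronglyMeasurable (t k)
      (ae_of_all _ fun w => by
        rw [Real.norm_eq_abs, abs_of_nonneg chainExit_nonneg]
        exact chainExit_le (ht0 k).le)
  have hexitm : ∀ k, ExpectedSupLE Q
      (fun i (_ : Ω) => 2 * n * ∫ w, chainExit l u H t (path i) k w ∂P)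
      (√n * σ * √L * ((k + 2) / 2 ^ k)) := fun k => by
    refine ExpectedSupLE.const fun i => ?_
    rw [abs_of_nonneg (mul_nonneg (by positivity)
      (integral_nonneg fun w => chainExit_nonneg))]
    -- Dividing by `t (k + 1)` brings in `√L (k + 3)`, so the means form a convergent series like
    -- the centred sums.
    have h1 : ∫ w, chainExit l u H t (path i) k w ∂P ≤ (σ / 2 ^ (k + 1)) ^ 2 / t (k + 1) := by
      refine (integral_mono (hexiti _ k) ((hgi2 (path i) (k + 1)).div_const (t (k + 1)))
        fun w => chainExit_le_sq (ht0 _)).trans ?_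
      rw [integral_div]
      exact div_le_div_of_nonneg_right (hg2 _ _) (ht0 _).le
    calc 2 * n * ∫ w, chainExit l u H t (path i) k w ∂P
        ≤ 2 * n * ((σ / 2 ^ (k + 1)) ^ 2 / t (k + 1)) :=
          mul_le_mul_of_nonneg_left h1 (by positivity)
      _ = √n * σ * √L * ((k + 3) / 2 ^ (k + 1)) := by
          simp only [ht]
          rw [← hnn]
          simp only [Real.sqrt_mul_self hsn.le]
          push_cast
          field_simp
          ring
      _ ≤ _ := by
          refine mul_le_mul_of_nonneg_left ?_ (by positivity)
          rw [pow_succ, div_le_div_iff₀ (by positivity) (by positivity)]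
          have : (0 : ℝ) < 2 ^ k := by positivity
          have hk : (0 : ℝ) ≤ k := by positivity
          nlinarith [mul_nonneg hk this.le]
  -- the end of the chain
  set K := I.card with hK
  have hKpow : ((K : ℝ) + 2) / 2 ^ K ≤ 2 := by
    rw [div_le_iff₀ (by positivity)]
    have : (K : ℝ) + 1 ≤ 2 ^ K := by exact_mod_cast K.lt_two_pow_self
    have hk : (0 : ℝ) ≤ K := by positivity
    linarith
  have hfinal : ExpectedSupLE Q (fun i => centredSum P W I (chainFinal l u H t (path i) K))
      (10 * (√n * σ * √L)) := by
    refine (expectedSupLE_path hW hind I hpath (K + 1) (t := t K) (L := L * (K + 2) ^ 2)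
      (g := fun j => chainFinal l u H t j K) (fun j => measurable_chainFinal hl hu hH t j K)
      (fun j j' h => chainFinal_congr h) (ht0 K) (fun j w => ?_) (hcard1 K) fun j => ?_).mono ?_
    · rw [abs_of_nonneg chainFinal_nonneg]
      exact chainFinal_le (ht0 K).le
    · exact hbd K _ (hsmall _ j K (fun w => chainFinal_nonneg) fun w => chainFinal_le_gap)
    · rw [htL]
      have : 0 < √n * σ * √L := by positivity
      nlinarith
  have hfinali : ∀ j, Integrable (chainFinal l u H t j K) P := fun j =>
    Integrable.of_bound (measurable_chainFinal hl hu hH t j K).aestronglyMeasurable (t K)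
      (ae_of_all _ fun w => by
        rw [Real.norm_eq_abs, abs_of_nonneg chainFinal_nonneg]
        exact chainFinal_le (ht0 K).le)
  have hfinalm : ExpectedSupLE Q
      (fun i (_ : Ω) => 2 * n * ∫ w, chainFinal l u H t (path i) K w ∂P)
      (2 * (√n * σ * √L)) := by
    refine ExpectedSupLE.const fun i => ?_
    rw [abs_of_nonneg (mul_nonneg (by positivity)
      (integral_nonneg fun w => chainFinal_nonneg))]
    have h1 : ∫ w, chainFinal l u H t (path i) K w ∂P ≤ σ / 2 ^ K := by
      obtain ⟨h2, h3⟩ := integral_le_of_sq (hgm (path i) K) (hgi2 _ K)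
        (c := σ / 2 ^ K) (by positivity) (hg2 _ _)
      exact (integral_mono (hfinali _) h2 fun w => chainFinal_le_gap).trans h3
    -- The depth `K` is the sample size. Any depth with `√n ≤ 2ᴷ` makes `n` times the mean final
    -- width at most `√n σ`.
    have h2 : √n / 2 ^ K ≤ 1 := by
      rw [div_le_one (by positivity)]
      refine (Real.sqrt_le_sqrt (show n ≤ (2 ^ K) ^ 2 by
        have h3 : n ≤ 2 ^ K := by rw [hn]; exact_mod_cast K.lt_two_pow_self.le
        have h4 : (1 : ℝ) ≤ 2 ^ K := one_le_pow₀ (by norm_num)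
        nlinarith)).trans (le_of_eq (Real.sqrt_sq (by positivity)))
    calc 2 * n * ∫ w, chainFinal l u H t (path i) K w ∂P ≤ 2 * n * (σ / 2 ^ K) :=
          mul_le_mul_of_nonneg_left h1 (by positivity)
      _ = 2 * (√n * σ) * (√n / 2 ^ K) := by rw [← hnn]; simp only [Real.sqrt_mul_self hsn.le]; ring
      _ ≤ 2 * (√n * σ) * 1 := mul_le_mul_of_nonneg_left h2 (by positivity)
      _ ≤ 2 * (√n * σ * √L) := by
          have : 0 < √n * σ := by positivity
          nlinarith
  -- the tail of the envelope
  have hEm := measurable_envelopeTail hH (t 0)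
  have hE0 : ∀ w, 0 ≤ 3 * envelopeTail H (t 0) w := fun w => by
    have := envelopeTail_nonneg (hH0 w) (t 0)
    positivity
  have hEi' : Integrable (envelopeTail H (t 0)) P :=
    hHi.mono' hEm.aestronglyMeasurable (ae_of_all _ fun w => by
      rw [Real.norm_eq_abs, abs_of_nonneg (envelopeTail_nonneg (hH0 w) _)]
      exact envelopeTail_le (hH0 w) _)
  have hEi : Integrable (fun w => 3 * envelopeTail H (t 0) w) P := hEi'.const_mul 3
  have hEW : ∀ k, Integrable (fun ω => 3 * envelopeTail H (t 0) (W k ω)) Q := fun k =>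
    ((hW k).integrable_comp hEi.aestronglyMeasurable).2 hEi
  -- The tail is not small pointwise, so no cancellation is sought: the centred sum plus twice the
  -- mean is a nonnegative sum plus one mean, of total expectation `2 * 3 * n` times the tail
  -- integral.
  have htail : ExpectedSupLE Q (fun (_ : ι) ω => centredSum P W I
      (fun w => 3 * envelopeTail H (t 0) w) ω + 2 * n * ∫ w, 3 * envelopeTail H (t 0) w ∂P)
      (6 * (n * ∫ w, envelopeTail H (t 0) w ∂P)) := by
    refine ⟨fun ω => ∑ k ∈ I, 3 * envelopeTail H (t 0) (W k ω)
      + n * ∫ w, 3 * envelopeTail H (t 0) w ∂P,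
      (integrable_finsetSum _ fun k _ => hEW k).add (integrable_const _),
      ae_of_all _ fun ω i => ?_, ?_⟩
    · have h0 : 0 ≤ ∑ k ∈ I, 3 * envelopeTail H (t 0) (W k ω) :=
        Finset.sum_nonneg fun k _ => hE0 _
      have h1 : 0 ≤ n * ∫ w, 3 * envelopeTail H (t 0) w ∂P :=
        mul_nonneg hn0.le (integral_nonneg hE0)
      have h2 : centredSum P W I (fun w => 3 * envelopeTail H (t 0) w) ω
          = ∑ k ∈ I, 3 * envelopeTail H (t 0) (W k ω)
            - n * ∫ w, 3 * envelopeTail H (t 0) w ∂P := by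
        simp [centredSum, hn, hK]
      beta_reduce
      rw [h2, abs_of_nonneg (by linarith)]
      linarith
    · rw [integral_add (integrable_finsetSum _ fun k _ => hEW k) (integrable_const _),
        integral_finsetSum _ fun k _ => hEW k]
      have h1 : ∀ k, ∫ ω, 3 * envelopeTail H (t 0) (W k ω) ∂Q
          = ∫ w, 3 * envelopeTail H (t 0) w ∂P := fun k => by
        rw [← (hW k).map_eq, integral_map (hW k).measurable.aemeasurable]
        exact (hEm.const_mul 3).aestronglyMeasurable
      simp only [h1, integral_const_mul, Finset.sum_const, nsmul_eq_mul, integral_const,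
        probReal_univ, one_smul]
      rw [hn, hK]
      linarith
  -- the decomposition
  let p : ι → S → ℝ := fun i w => chainStart l H t (path i) w
    + ∑ k ∈ Finset.range K, chainLink l u H t (path i) k w
  let R : ι → S → ℝ := fun i w => 3 * envelopeTail H (t 0) w
    + (∑ k ∈ Finset.range K, chainExit l u H t (path i) k w + chainFinal l u H t (path i) K w)
  have hstarti : ∀ j, Integrable (chainStart l H t j) P := fun j =>
    Integrable.of_bound (measurable_chainStart hl hH t j).aestronglyMeasurable (t 0)
      (ae_of_all _ fun w => by
        unfold chainStart
        split_ifs with h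
        · exact h
        · simpa using (ht0 0).le)
  have hlinki : ∀ j k, Integrable (chainLink l u H t j k) P := fun j k =>
    Integrable.of_bound (measurable_chainLink hl hu hH t j k).aestronglyMeasurable (t k)
      (ae_of_all _ fun w => by
        rw [Real.norm_eq_abs, abs_of_nonneg chainLink_nonneg]
        exact chainLink_le_final.trans (chainFinal_le (ht0 k).le))
  have hpi : ∀ i, Integrable (p i) P := fun i =>
    (hstarti _).add (integrable_finsetSum _ fun k _ => hlinki _ k)
  have hsumi : ∀ i, Integrable (fun w => ∑ k ∈ Finset.range K, chainExit l u H t (path i) k w) P :=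
    fun i => integrable_finsetSum _ fun k _ => hexiti _ k
  have hsfi : ∀ i, Integrable (fun w => ∑ k ∈ Finset.range K, chainExit l u H t (path i) k w
      + chainFinal l u H t (path i) K w) P := fun i => (hsumi i).add (hfinali _)
  have hRi : ∀ i, Integrable (R i) P := fun i => hEi.add (hsfi i)
  have hFi : ∀ i, Integrable (F i) P := fun i => hHi.mono' (hF i) (by
    filter_upwards [hcov] with w hw using (hw i).1)
  have hFpR : ∀ᵐ w ∂P, ∀ i, |F i w - p i w| ≤ R i w := by
    filter_upwards [hcov] with w hw i
    exact abs_sub_chain_le (hH0 w) (hw i).1 (hw i).2 K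
  have hFpRW : ∀ᵐ ω ∂Q, ∀ m i, |F i (W m ω) - p i (W m ω)| ≤ R i (W m ω) :=
    ae_all_iff.2 fun m => (hW m).quasiMeasurePreserving.ae hFpR
  have hps : ∀ i ω, centredSum P W I (p i) ω = centredSum P W I (chainStart l H t (path i)) ω
      + ∑ k ∈ Finset.range K, centredSum P W I (chainLink l u H t (path i) k) ω := fun i ω => by
    rw [centredSum_add (hstarti _) (integrable_finsetSum _ fun k _ => hlinki _ k),
      centredSum_sum _ fun k _ => hlinki _ k]
  have hRs : ∀ i ω, centredSum P W I (R i) ω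
      = centredSum P W I (fun w => 3 * envelopeTail H (t 0) w) ω
      + (∑ k ∈ Finset.range K, centredSum P W I (chainExit l u H t (path i) k) ω
        + centredSum P W I (chainFinal l u H t (path i) K) ω) := fun i ω => by
    rw [centredSum_add hEi (hsfi i), centredSum_add (hsumi i) (hfinali _),
      centredSum_sum _ fun k _ => hexiti _ k]
  have hRint : ∀ i, ∫ w, R i w ∂P = ∫ w, 3 * envelopeTail H (t 0) w ∂P
      + (∑ k ∈ Finset.range K, ∫ w, chainExit l u H t (path i) k w ∂P
        + ∫ w, chainFinal l u H t (path i) K w ∂P) := fun i => by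
    rw [integral_add hEi (hsfi i), integral_add (hsumi i) (hfinali _),
      integral_finsetSum _ fun k _ => hexiti _ k]
  -- `40 = 10 + 5 * 6`: the start and the links, the series being at most `6`.
  have hp : ExpectedSupLE Q (fun i => centredSum P W I (p i)) (40 * (√n * σ * √L)) := by
    refine ((hstart.add (ExpectedSupLE.sum (Finset.range K) fun k _ => hlink k)).mono ?_).of_abs_le
      (ae_of_all _ fun ω i => by rw [hps])
    rw [← Finset.mul_sum]
    have := mul_le_mul_of_nonneg_left (sum_add_two_div_two_pow_le K)
      (show 0 ≤ 5 * (√n * σ * √L) by positivity)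
    linarith
  -- `48 = (5 + 1) * 6 + 10 + 2`: exits and their means, then the final width and its mean.
  have hR : ExpectedSupLE Q (fun i ω => centredSum P W I (R i) ω + 2 * n * ∫ w, R i w ∂P)
      (48 * (√n * σ * √L) + 6 * (n * ∫ w, envelopeTail H (t 0) w ∂P)) := by
    refine ((htail.add ((ExpectedSupLE.sum (Finset.range K) fun k _ =>
      (hexit k).add (hexitm k)).add (hfinal.add hfinalm))).mono ?_).of_abs_le
      (ae_of_all _ fun ω i => le_of_eq ?_)
    · have h1 : ∀ k : ℕ, 5 * (√n * σ * √L) * (((k : ℝ) + 2) / 2 ^ k)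
          + √n * σ * √L * ((k + 2) / 2 ^ k) = 6 * (√n * σ * √L) * ((k + 2) / 2 ^ k) :=
        fun k => by ring
      simp only [h1]
      rw [← Finset.mul_sum]
      have := mul_le_mul_of_nonneg_left (sum_add_two_div_two_pow_le K)
        (show 0 ≤ 6 * (√n * σ * √L) by positivity)
      linarith
    · rw [hRs, hRint]
      simp only [Finset.sum_add_distrib, ← Finset.mul_sum]
      congr 1
      ring
  rw [← htz]
  refine ((hp.add ((hR.of_abs_le (Y := fun i ω => centredSum P W I (F i) ω
    - centredSum P W I (p i) ω) ?_))).mono (by linarith)).of_abs_le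
    (ae_of_all _ fun ω i => by rw [add_sub_cancel])
  -- From `|F - p| ≤ R` the centred sum of `F - p` is at most the sum of `R` plus `n P R`, that is,
  -- the centred sum of `R` plus `2 n P R`.
  filter_upwards [hFpRW] with ω hω i
  refine le_trans ?_ (le_abs_self _)
  have h1 : centredSum P W I (F i) ω - centredSum P W I (p i) ω
      = ∑ m ∈ I, (F i (W m ω) - p i (W m ω)) - n * ∫ w, (F i w - p i w) ∂P := by
    simp only [centredSum, integral_sub (hFi i) (hpi i), Finset.sum_sub_distrib, Finset.sum_const,
      nsmul_eq_mul, hn, hK]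
    ring
  have h2 : centredSum P W I (R i) ω = ∑ m ∈ I, R i (W m ω) - n * ∫ w, R i w ∂P := by
    simp [centredSum, hn, hK]
  have h3 : |∑ m ∈ I, (F i (W m ω) - p i (W m ω))| ≤ ∑ m ∈ I, R i (W m ω) :=
    (Finset.abs_sum_le_sum_abs _ _).trans (Finset.sum_le_sum fun m _ => hω m i)
  have h4 : |∫ w, (F i w - p i w) ∂P| ≤ ∫ w, R i w ∂P := by
    refine abs_integral_le_integral_abs.trans
      (integral_mono_ae ((hFi i).sub (hpi i)).abs (hRi i) ?_)
    filter_upwards [hFpR] with w hw using hw i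
  rw [h1, h2]
  refine (abs_sub _ _).trans ?_
  rw [abs_mul, abs_of_pos hn0]
  nlinarith [mul_le_mul_of_nonneg_left h4 hn0.le]

end Chaining

/-! ### Bracketing numbers -/

section Bracketing

variable {S Ω : Type*} [MeasurableSpace S] [MeasurableSpace Ω] {P : Measure S}
  {Q : Measure Ω} {W : ℕ → Ω → S}

theorem exists_brackets_of_bracketingNumber_le {F : Set (S → ℝ)} {η : ℝ≥0∞} {x : ℝ} (hx : 0 ≤ x)
    (h : ((bracketingNumber P F η : ℕ∞) : ℝ≥0∞) ≤ ENNReal.ofReal x) :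
    ∃ N : ℕ, (N : ℝ) ≤ x ∧ ∃ l u : Fin N → S → ℝ,
      (∀ j, MemLp (l j) 2 P ∧ MemLp (u j) 2 P ∧ eLpNorm (fun w => u j w - l j w) 2 P ≤ η) ∧
      ∀ f ∈ F, ∃ j, ∀ w, l j w ≤ f w ∧ f w ≤ u j w := by
  have hne : bracketingNumber P F η ≠ ⊤ := fun ht => by
    rw [ht] at h
    simp at h
  obtain ⟨m, hm⟩ := ENat.ne_top_iff_exists.1 hne
  have hmx : (m : ℝ) ≤ x := by
    rw [← hm] at h
    have h' : (m : ℝ≥0∞) ≤ ENNReal.ofReal x := by simpa using h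
    rw [← ENNReal.ofReal_natCast] at h'
    exact (ENNReal.ofReal_le_ofReal_iff hx).1 h'
  have hlt : bracketingNumber P F η < ((m + 1 : ℕ) : ℕ∞) := by
    rw [← hm]
    exact_mod_cast Nat.lt_succ_self m
  unfold bracketingNumber at hlt
  obtain ⟨N, hN⟩ := iInf_lt_iff.1 hlt
  obtain ⟨hex, hN⟩ := iInf_lt_iff.1 hN
  have hNm : N ≤ m := Nat.lt_succ_iff.1 (by exact_mod_cast hN)
  exact ⟨N, (Nat.cast_le.2 hNm).trans hmx, hex⟩

theorem bracketingNumber_anti {F : Set (S → ℝ)} {η η' : ℝ≥0∞} (h : η ≤ η') :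
    bracketingNumber P F η' ≤ bracketingNumber P F η := by
  refine le_iInf fun N => le_iInf fun hN => iInf_le_of_le N (iInf_le_of_le ?_ le_rfl)
  obtain ⟨l, u, h1, h2⟩ := hN
  exact ⟨l, u, fun j => ⟨(h1 j).1, (h1 j).2.1, (h1 j).2.2.trans h⟩, h2⟩

theorem integral_sq_le_of_eLpNorm_le {g : S → ℝ} (hg : MemLp g 2 P) {c : ℝ} (hc : 0 ≤ c)
    (h : eLpNorm g 2 P ≤ ENNReal.ofReal c) : ∫ w, g w ^ 2 ∂P ≤ c ^ 2 := by
  rw [hg.eLpNorm_eq_integral_rpow_norm (by norm_num) (by norm_num),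
    ENNReal.ofReal_le_ofReal_iff hc] at h
  simp only [ENNReal.toReal_ofNat, Real.rpow_ofNat, Real.norm_eq_abs, sq_abs] at h
  have h0 : 0 ≤ ∫ w, g w ^ 2 ∂P := integral_nonneg fun w => sq_nonneg _
  have h1 := pow_le_pow_left₀ (by positivity) h 2
  rwa [← Real.rpow_natCast, ← Real.rpow_mul h0, Nat.cast_ofNat,
    inv_mul_cancel₀ (by norm_num : (2 : ℝ) ≠ 0), Real.rpow_one] at h1

/-- The bracketing maximal inequality in terms of bracketing numbers. -/
theorem expectedSupLE_of_bracketingNumber [IsProbabilityMeasure P] [IsProbabilityMeasure Q]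
    (hW : ∀ i, MeasurePreserving (W i) Q P) (hind : iIndepFun W Q) {I : Finset ℕ}
    (hI : I.Nonempty) {F : Set (S → ℝ)} (hF : ∀ f ∈ F, AEStronglyMeasurable f P)
    {H : S → ℝ} (hH : Measurable H) (hH2 : MemLp H 2 P) (henv : IsEnvelope P F H)
    {σ L : ℝ} (hσ : 0 < σ) (hL : 1 ≤ L)
    (hFσ : ∀ f ∈ F, eLpNorm f 2 P ≤ ENNReal.ofReal σ)
    (hN : ∀ k : ℕ, ((bracketingNumber P F (ENNReal.ofReal (σ / 2 ^ k)) : ℕ∞) : ℝ≥0∞)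
      ≤ ENNReal.ofReal (Real.exp (L * (k + 1)) / 2)) :
    ExpectedSupLE Q (fun f : F => centredSum P W I f)
      (88 * (√I.card * σ * √L)
        + 6 * (I.card * ∫ w, envelopeTail (fun w => |H w|) (√I.card * σ / √L) w ∂P)) := by
  classical
  choose N hNx l u hlu hcov using fun k =>
    exists_brackets_of_bracketingNumber_le (by positivity) (hN k)
  -- Brackets that contain no member of the class are replaced by zero: nothing bounds their lower
  -- ends. A bracket with a member `f` has `‖l‖ ≤ ‖f‖ + ‖u - l‖ ≤ 2 σ` at level `0`. The others are
  -- replaced by measurable versions.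
  let good : ∀ k, Fin (N k) → Prop := fun k j => ∃ f ∈ F, ∀ w, l k j w ≤ f w ∧ f w ≤ u k j w
  let l' : ℕ → ℕ → S → ℝ := fun k j => if h : j < N k then
    if good k ⟨j, h⟩ then (hlu k ⟨j, h⟩).1.1.mk _ else 0 else 0
  let u' : ℕ → ℕ → S → ℝ := fun k j => if h : j < N k then
    if good k ⟨j, h⟩ then (hlu k ⟨j, h⟩).2.1.1.mk _ else 0 else 0
  have hl' : ∀ k j, Measurable (l' k j) := fun k j => by
    simp only [l']
    split_ifs
    exacts [(AEStronglyMeasurable.stronglyMeasurable_mk _).measurable, measurable_zero,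
      measurable_zero]
  have hu' : ∀ k j, Measurable (u' k j) := fun k j => by
    simp only [u']
    split_ifs
    exacts [(AEStronglyMeasurable.stronglyMeasurable_mk _).measurable, measurable_zero,
      measurable_zero]
  have hlae : ∀ k (j : Fin (N k)), good k j → l' k j =ᵐ[P] l k j := fun k j h => by
    simp only [l', j.2, Fin.eta, h, dif_pos, if_true]
    exact (hlu k j).1.1.ae_eq_mk.symm
  have huae : ∀ k (j : Fin (N k)), good k j → u' k j =ᵐ[P] u k j := fun k j h => by
    simp only [u', j.2, Fin.eta, h, dif_pos, if_true]
    exact (hlu k j).2.1.1.ae_eq_mk.symm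
  have hbad : ∀ k j, (¬ ∃ h : j < N k, good k ⟨j, h⟩) → l' k j = 0 ∧ u' k j = 0 := by
    intro k j h
    by_cases hj : j < N k
    · have hg : ¬ good k ⟨j, hj⟩ := fun hg => h ⟨hj, hg⟩
      simp [l', u', hj, hg]
    · simp [l', u', hj]
  have hulmem : ∀ k j, MemLp (fun w => u' k j w - l' k j w) 2 P ∧
      eLpNorm (fun w => u' k j w - l' k j w) 2 P ≤ ENNReal.ofReal (σ / 2 ^ k) := by
    intro k j
    by_cases h : ∃ h : j < N k, good k ⟨j, h⟩
    · obtain ⟨hj, hg⟩ := h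
      have hae : (fun w => u' k j w - l' k j w) =ᵐ[P] fun w => u k ⟨j, hj⟩ w - l k ⟨j, hj⟩ w :=
        (huae k ⟨j, hj⟩ hg).sub (hlae k ⟨j, hj⟩ hg)
      rw [eLpNorm_congr_ae hae, memLp_congr_ae hae]
      exact ⟨(hlu k ⟨j, hj⟩).2.1.sub (hlu k ⟨j, hj⟩).1, (hlu k ⟨j, hj⟩).2.2⟩
    · obtain ⟨h1, h2⟩ := hbad k j h
      simp [h1, h2]
  have hl0mem : ∀ j, MemLp (l' 0 j) 2 P ∧ eLpNorm (l' 0 j) 2 P ≤ ENNReal.ofReal (2 * σ) := by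
    intro j
    by_cases h : ∃ h : j < N 0, good 0 ⟨j, h⟩
    · obtain ⟨hj, hg⟩ := h
      obtain ⟨f, hf, hfw⟩ := id hg
      rw [eLpNorm_congr_ae (hlae 0 ⟨j, hj⟩ hg), memLp_congr_ae (hlae 0 ⟨j, hj⟩ hg)]
      refine ⟨(hlu 0 ⟨j, hj⟩).1, ?_⟩
      have h1 : eLpNorm (f - l 0 ⟨j, hj⟩) 2 P ≤ ENNReal.ofReal σ := by
        refine (eLpNorm_mono fun w => ?_).trans ((hlu 0 ⟨j, hj⟩).2.2.trans (by simp))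
        rw [Pi.sub_apply, Real.norm_eq_abs, Real.norm_eq_abs, abs_of_nonneg, abs_of_nonneg] <;>
          linarith [(hfw w).1, (hfw w).2]
      have h2 : l 0 ⟨j, hj⟩ = f - (f - l 0 ⟨j, hj⟩) := by simp
      rw [h2, two_mul, ENNReal.ofReal_add hσ.le hσ.le]
      refine (eLpNorm_sub_le (hF f hf) ((hF f hf).sub (hlu 0 ⟨j, hj⟩).1.1) (by norm_num)).trans ?_
      exact add_le_add (hFσ f hf) h1
    · obtain ⟨h1, -⟩ := hbad 0 j h
      simp [h1]
  choose path hpath using fun (f : F) (k : ℕ) => hcov k f f.2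
  refine expectedSupLE_bracketing hW hind hI (F := fun f : F => (f : S → ℝ))
    (fun f => hF f f.2) (hH.abs) (hH2.integrable (by norm_num)).abs (fun w => abs_nonneg _)
    (N := N) hl' hu' hσ hL (fun k => by linarith [hNx k]) (fun k j => (hulmem k j).1.integrable_sq)
    (fun k j => integral_sq_le_of_eLpNorm_le (hulmem k j).1 (by positivity) (hulmem k j).2)
    (fun j => (hl0mem j).1.integrable_sq)
    (fun j => integral_sq_le_of_eLpNorm_le (hl0mem j).1 (by positivity) (hl0mem j).2)
    (path := fun f k => path f k) (fun f k => (path f k).2) ?_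
  -- There are countably many brackets, so a single null set serves the whole class.
  have hall : ∀ᵐ w ∂P, ∀ k (j : Fin (N k)), good k j → l' k j w = l k j w ∧ u' k j w = u k j w := by
    refine ae_all_iff.2 fun k => ae_all_iff.2 fun j => ?_
    by_cases hg : good k j
    · filter_upwards [hlae k j hg, huae k j hg] with w h1 h2 _ using ⟨h1, h2⟩
    · exact ae_of_all _ fun w h => absurd h hg
  filter_upwards [henv, hall] with w h1 h2 f
  refine ⟨(h1 f f.2).trans (le_abs_self _), fun k => ?_⟩
  obtain ⟨h3, h4⟩ := h2 k (path f k) ⟨f, f.2, hpath f k⟩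
  rw [h3, h4]
  exact hpath f k w

end Bracketing

/-! ### Outer expectations -/

section Outer

variable {Ω : Type*} [MeasurableSpace Ω] {Q : Measure Ω}

/-- A majorant that is valid almost everywhere becomes one everywhere when set to `⊤` on a
measurable null set containing the exceptions. -/
theorem outerExpectation_le_lintegral {f g : Ω → ℝ≥0∞} (hg : AEMeasurable g Q)
    (hfg : ∀ᵐ ω ∂Q, f ω ≤ g ω) : outerExpectation Q f ≤ ∫⁻ ω, g ω ∂Q := by
  classical
  have h : ∀ᵐ ω ∂Q, f ω ≤ hg.mk g ω := by
    filter_upwards [hfg, hg.ae_eq_mk] with ω h1 h2 using h2 ▸ h1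
  set A := toMeasurable Q {ω | ¬ f ω ≤ hg.mk g ω} with hA
  have hA0 : Q A = 0 := by rw [hA, measure_toMeasurable]; exact h
  have hAe : ∀ᵐ ω ∂Q, ω ∉ A := measure_eq_zero_iff_ae_notMem.1 hA0
  have hm : Measurable fun ω => if ω ∈ A then ⊤ else hg.mk g ω :=
    Measurable.ite (measurableSet_toMeasurable _ _) measurable_const hg.measurable_mk
  have hle : ∀ ω, f ω ≤ if ω ∈ A then ⊤ else hg.mk g ω := fun ω => by
    split_ifs with hω
    · exact le_top
    · by_contra hn
      exact hω (subset_toMeasurable Q _ hn)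
  have hmain : outerExpectation Q f ≤ ∫⁻ ω, (if ω ∈ A then ⊤ else hg.mk g ω) ∂Q := by
    unfold outerExpectation
    exact iInf_le_of_le _ (iInf_le_of_le hm (iInf_le_of_le hle le_rfl))
  refine hmain.trans (le_of_eq ?_)
  refine lintegral_congr_ae ?_
  filter_upwards [hAe, hg.ae_eq_mk] with ω h1 h2
  rw [if_neg h1, h2]

theorem ExpectedSupLE.outerExpectation_le {ι : Type*} {X : ι → Ω → ℝ} {b : ℝ}
    (h : ExpectedSupLE Q X b) {f : Ω → ℝ≥0∞} (hf : ∀ ω, f ω ≤ ⨆ i, ENNReal.ofReal |X i ω|) :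
    outerExpectation Q f ≤ ENNReal.ofReal b := by
  obtain ⟨G, hG, hX, hb⟩ := h
  -- For an empty index set the majorant need not be nonnegative, but the supremum is zero.
  rcases isEmpty_or_nonempty ι with hι | ⟨⟨i⟩⟩
  · refine (outerExpectation_le_lintegral (g := 0) aemeasurable_const
      (ae_of_all _ fun ω => ?_)).trans (by simp)
    simpa using hf ω
  · have hG0 : 0 ≤ᵐ[Q] G := by
      filter_upwards [hX] with ω hω using (abs_nonneg _).trans (hω i)
    refine (outerExpectation_le_lintegral (g := fun ω => ENNReal.ofReal (G ω))
      hG.aemeasurable.ennreal_ofReal ?_).trans ?_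
    · filter_upwards [hX] with ω hω
      exact (hf ω).trans (iSup_le fun i => ENNReal.ofReal_le_ofReal (hω i))
    · rw [← ofReal_integral_eq_lintegral_ofReal hG hG0]
      exact ENNReal.ofReal_le_ofReal hb

end Outer

/-! ### Measurability of the risk terms -/

section Measurability

theorem measurable_boundaryKernel (κ : ℕ) (τ a x : ℝ) : Measurable (boundaryKernel κ τ a x) := by
  unfold boundaryKernel
  split_ifs
  · refine Measurable.ite ((measurableSet_le measurable_const measurable_id).inter
      (measurableSet_le measurable_id measurable_const)) ?_ measurable_const
    unfold kernelCentral
    fun_prop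
  · refine Measurable.ite ((measurableSet_le measurable_const measurable_id).inter
      (measurableSet_le measurable_id measurable_const)) ?_ measurable_const
    unfold kernelLeft
    fun_prop
  · refine Measurable.ite ((measurableSet_le measurable_const measurable_id).inter
      (measurableSet_le measurable_id measurable_const)) ?_ measurable_const
    unfold kernelRight
    fun_prop
  · exact measurable_const

variable {S : Type*} [MeasurableSpace S] {d : ℕ} {τ : ℝ}

theorem measurable_riskWeight (D : EventHistory S d τ) (m : ℕ) (u : ℝ) (β : Fin d → ℝ) :
    Measurable (riskWeight D m u β) := by
  classical
  have h1 : Measurable (atRisk D m u) := by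
    unfold atRisk
    refine Measurable.ite ?_ measurable_const measurable_const
    exact (measurableSet_lt (D.measurable_T m) (D.measurable_C m)).inter
      ((measurableSet_le measurable_const ((D.measurable_T (m + 1)).sub (D.measurable_T m))).inter
        (measurableSet_le measurable_const ((D.measurable_C m).sub (D.measurable_T m))))
  have h2 : Measurable fun w => β ⬝ᵥ D.Z m u w := by
    unfold dotProduct
    have := fun i => (measurable_pi_iff.1 (D.measurable_Z m u)) i
    fun_prop
  exact h1.mul (Real.measurable_exp.comp h2)

theorem measurable_normalizedTerm (D : EventHistory S d τ) (s : ℝ → (Fin d → ℝ) → ℝ → ℝ) (κ : ℕ)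
    (a u : ℝ) (β : Fin d → ℝ) (x : ℝ) : Measurable (normalizedTerm D s κ a u β x) :=
  (Measurable.tsum fun m => (measurable_riskWeight D m u β).mul
    ((measurable_boundaryKernel κ τ a x).comp (D.measurable_X m))).const_mul _

end Measurability

/-! ### Deviations of the risk processes -/

section Deviation

variable {S Ω : Type*} [MeasurableSpace S] {P : Measure S} {W : ℕ → Ω → S} {d : ℕ} {τ : ℝ}

theorem leaveOneOut_sub_meanRisk_div (D : EventHistory S d τ)
    {s : ℝ → (Fin d → ℝ) → ℝ → ℝ} (κ : ℕ) (a : ℝ) {n i : ℕ} (hn : 2 ≤ n) (hi : i < n)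
    (u : ℝ) (β : Fin d → ℝ) (x : ℝ) (ω : Ω) :
    (leaveOneOut D κ a W n i u β x ω - meanRisk P D κ a u β x) / s u β x
      = (((n : ℝ) - 1) * a)⁻¹ *
        centredSum P W ((Finset.range n).erase i) (normalizedTerm D s κ a u β x) ω := by
  have hcard : (((Finset.range n).erase i).card : ℝ) = n - 1 := by
    rw [Finset.card_erase_of_mem (Finset.mem_range.2 hi), Finset.card_range,
      Nat.cast_sub (by omega), Nat.cast_one]
  have hn1 : (n : ℝ) - 1 ≠ 0 := by
    have : (2 : ℝ) ≤ n := by exact_mod_cast hn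
    linarith
  simp only [centredSum, Finset.sum_sub_distrib, Finset.sum_const, nsmul_eq_mul, hcard,
    normalizedTerm, integral_const_mul, ← Finset.mul_sum, leaveOneOut, meanRisk]
  rw [div_eq_mul_inv, mul_inv]
  field_simp

variable [MeasurableSpace Ω] {Q : Measure Ω}

/-- Bounds for the expected suprema of the centred sums over large subsamples give the order of
the deviations. -/
theorem deviationOrder_of_expectedSupLE {D : EventHistory S d τ}
    {s : ℝ → (Fin d → ℝ) → ℝ → ℝ} {κ : ℕ} {a : ℕ → ℝ} (ha : ∀ n, 0 < a n)
    {B : Set (Fin d → ℝ)} {G : ℕ → Set (ℝ × ℝ)} {rate : ℕ → ℝ} {C : ℝ} (hC : 0 ≤ C)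
    (h : ∀ᶠ n : ℕ in atTop, ∀ I ⊆ Finset.range n, n ≤ 2 * I.card →
      ExpectedSupLE Q (fun f : termClass D s κ (a n) B (G n) => centredSum P W I f)
        (C * (n * a n * rate n))) :
    DeviationOrder P D s κ a B G Q W rate := by
  -- Both normalizations satisfy `c * (n * a n) ≤ 2`: the product is `1` for the full sample and `n
  -- / (n - 1)` when one subject is left out.
  have key : ∀ (n : ℕ) (I : Finset ℕ) (c : ℝ) (f : Ω → ℝ≥0∞), 0 ≤ c → c * (n * a n) ≤ 2 →
      ExpectedSupLE Q (fun f : termClass D s κ (a n) B (G n) => centredSum P W I f)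
        (C * (n * a n * rate n)) →
      (∀ ω, f ω = ⨆ z ∈ G n, ⨆ β ∈ B,
        ENNReal.ofReal |c * centredSum P W I (normalizedTerm D s κ (a n) z.1 β z.2) ω|) →
      outerExpectation Q f ≤ (Real.toNNReal (2 * C) : ℝ≥0∞) * ENNReal.ofReal (rate n) := by
    intro n I c f hc hcn hE hf
    have hna : 0 ≤ (n : ℝ) * a n := mul_nonneg (by positivity) (ha n).le
    refine ((hE.const_mul c).outerExpectation_le (f := f) fun ω => ?_).trans ?_
    · rw [hf]
      refine iSup₂_le fun z hz => iSup₂_le fun β hβ => ?_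
      exact le_iSup (fun f : termClass D s κ (a n) B (G n) =>
        ENNReal.ofReal |c * centredSum P W I f ω|) ⟨_, z, hz, β, hβ, rfl⟩
    · rw [abs_of_nonneg hc,
        show c * (C * (n * a n * rate n)) = (c * (n * a n) * C) * rate n by ring,
        ENNReal.ofReal_mul (mul_nonneg (mul_nonneg hc hna) hC)]
      exact mul_le_mul_left (ENNReal.ofReal_le_ofReal (mul_le_mul_of_nonneg_right hcn hC)) _
  refine ⟨⟨Real.toNNReal (2 * C), ?_⟩, ⟨Real.toNNReal (2 * C), ?_⟩⟩
  · filter_upwards [h, eventually_ge_atTop 2] with n hn hn2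
    have hna : 0 < (n : ℝ) * a n := mul_pos (by positivity) (ha n)
    refine key n (Finset.range n) (n * a n)⁻¹ _ (by positivity) ?_
      (hn _ subset_rfl (by simp; omega)) fun ω => rfl
    rw [inv_mul_cancel₀ hna.ne']
    norm_num
  · filter_upwards [h, eventually_ge_atTop 2] with n hn hn2
    refine iSup₂_le fun i hi => ?_
    have hin := Finset.mem_range.1 hi
    have hn2' : (2 : ℝ) ≤ n := by exact_mod_cast hn2
    have hn1 : 0 < ((n : ℝ) - 1) * a n := mul_pos (by linarith) (ha n)
    refine key n ((Finset.range n).erase i) (((n : ℝ) - 1) * a n)⁻¹ _ (by positivity) ?_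
      (hn _ (Finset.erase_subset _ _) ?_) fun ω => ?_
    · rw [inv_mul_le_iff₀ hn1]
      nlinarith [ha n]
    · rw [Finset.card_erase_of_mem hi, Finset.card_range]
      omega
    · simp only [supLeaveOneOut]
      simp only [leaveOneOut_sub_meanRisk_div D κ (a n) hn2 hin]

end Deviation

/-! ### Rates -/

section Rates

/-- With `ε = 1 / (2ᵏ y)` this turns polynomial bracketing into the growth `exp (L (k + 1)) / 2`
needed for chaining. The summand `1` in the constant absorbs the factor `2`, and `|log A|` covers `A
< 1`. -/
theorem rpow_le_exp_div_two {A V y ell : ℝ} (hA : 0 < A) (hV : 0 < V) (hy : 0 < y)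
    (hell : 1 ≤ ell) (hlog : Real.log y ≤ ell) (k : ℕ) :
    (A * 2 ^ k * y) ^ V ≤ Real.exp ((V * (|Real.log A| + 2) + 1) * ell * (k + 1)) / 2 := by
  have hp : 0 < A * 2 ^ k * y := by positivity
  rw [le_div_iff₀ two_pos, Real.rpow_def_of_pos hp,
    ← Real.exp_log (show (0 : ℝ) < 2 by norm_num), ← Real.exp_add, Real.exp_log two_pos]
  refine Real.exp_le_exp.2 ?_
  rw [Real.log_mul (by positivity) hy.ne', Real.log_mul hA.ne' (by positivity), Real.log_pow]
  have h2 : Real.log 2 ≤ 1 := by linarith [Real.log_two_lt_d9]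
  have hk : (0 : ℝ) ≤ k := by positivity
  have hA' : Real.log A ≤ |Real.log A| * ell :=
    (le_abs_self _).trans (le_mul_of_one_le_right (abs_nonneg _) hell)
  have hk2 : (k : ℝ) * Real.log 2 ≤ k * ell := mul_le_mul_of_nonneg_left (h2.trans hell) hk
  have h3 : Real.log A + k * Real.log 2 + Real.log y ≤ (|Real.log A| + 2) * ell * (k + 1) := by
    have h4 : 0 ≤ |Real.log A| * ell * k := by positivity
    have h5 : 0 ≤ ell * k := by positivity
    nlinarith
  have h6 : 0 ≤ ell * k := by positivity
  nlinarith [mul_le_mul_of_nonneg_left h3 hV.le]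

variable {S : Type*} [MeasurableSpace S] {P : Measure S}

/-- Markov's argument: where `2 |H| > T`, the factor `(2 |H| / T)^(p - 1)` is at least one. -/
theorem integral_envelopeTail_le {H : S → ℝ} {p T m : ℝ} (hT : 0 < T)
    (hp : 1 ≤ p) (hi : Integrable (fun w => |H w| ^ p) P) (hm : ∫ w, |H w| ^ p ∂P ≤ m) :
    ∫ w, envelopeTail (fun w => |H w|) T w ∂P ≤ (2 / T) ^ (p - 1) * m := by
  have hpt : ∀ w, envelopeTail (fun w => |H w|) T w ≤ (2 / T) ^ (p - 1) * |H w| ^ p := fun w => by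
    unfold envelopeTail
    split_ifs with h
    · have h0 : 0 < |H w| := by linarith
      have h1 : |H w| ^ p = |H w| ^ (p - 1) * |H w| := by
        rw [← Real.rpow_add_one h0.ne', sub_add_cancel]
      rw [h1, ← mul_assoc, ← Real.mul_rpow (by positivity) h0.le]
      refine le_mul_of_one_le_left h0.le (Real.one_le_rpow ?_ (by linarith))
      rw [div_mul_eq_mul_div, one_le_div hT]
      exact h.le
    · positivity
  calc ∫ w, envelopeTail (fun w => |H w|) T w ∂P
      ≤ ∫ w, (2 / T) ^ (p - 1) * |H w| ^ p ∂P :=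
        integral_mono_of_nonneg (ae_of_all _ fun w => envelopeTail_nonneg (abs_nonneg _) _)
          (hi.const_mul _) (ae_of_all _ hpt)
    _ = (2 / T) ^ (p - 1) * ∫ w, |H w| ^ p ∂P := integral_const_mul _ _
    _ ≤ _ := mul_le_mul_of_nonneg_left hm (by positivity)

theorem integrable_of_lintegral_ofReal_le {g : S → ℝ} (hg : Measurable g) (hg0 : ∀ w, 0 ≤ g w)
    {c : ℝ} (hc : 0 ≤ c) (h : ∫⁻ w, ENNReal.ofReal (g w) ∂P ≤ ENNReal.ofReal c) :
    Integrable g P ∧ ∫ w, g w ∂P ≤ c := by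
  have hi : Integrable g P := ⟨hg.aestronglyMeasurable, by
    rw [hasFiniteIntegral_iff_ofReal (ae_of_all _ hg0)]
    exact h.trans_lt ENNReal.ofReal_lt_top⟩
  refine ⟨hi, ?_⟩
  rwa [← ofReal_integral_eq_lintegral_ofReal hi (ae_of_all _ hg0),
    ENNReal.ofReal_le_ofReal_iff hc] at h

theorem memLp_two_of_integral_sq_le {g : S → ℝ} (hg : Measurable g)
    (hi : Integrable (fun w => g w ^ 2) P) {c : ℝ} (hc : 0 ≤ c) (h : ∫ w, g w ^ 2 ∂P ≤ c ^ 2) :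
    MemLp g 2 P ∧ eLpNorm g 2 P ≤ ENNReal.ofReal c := by
  have hm : MemLp g 2 P := (memLp_two_iff_integrable_sq hg.aestronglyMeasurable).2 hi
  refine ⟨hm, ?_⟩
  rw [hm.eLpNorm_eq_integral_rpow_norm (by norm_num) (by norm_num)]
  refine ENNReal.ofReal_le_ofReal ?_
  simp only [ENNReal.toReal_ofNat, Real.rpow_ofNat, Real.norm_eq_abs, sq_abs]
  refine (Real.rpow_le_rpow (integral_nonneg fun w => sq_nonneg _) h (by norm_num)).trans
    (le_of_eq ?_)
  rw [← Real.rpow_natCast, ← Real.rpow_mul hc]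
  simp

variable {Ω : Type*} [MeasurableSpace Ω] {Q : Measure Ω} {W : ℕ → Ω → S} {d : ℕ} {τ : ℝ}

/-- The order of the deviations when the envelope has a second moment of order `a`. -/
theorem deviationOrder_of_secondMoment [IsProbabilityMeasure P] [IsProbabilityMeasure Q]
    (hW : ∀ i, MeasurePreserving (W i) Q P) (hind : iIndepFun W Q) (D : EventHistory S d τ)
    (s : ℝ → (Fin d → ℝ) → ℝ → ℝ) (κ : ℕ) {a : ℕ → ℝ} (ha : ∀ n, 0 < a n)
    (B : Set (Fin d → ℝ)) (G : ℕ → Set (ℝ × ℝ)) {H : ℕ → S → ℝ} (hH : ∀ n, Measurable (H n))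
    (henv : ∀ᶠ n in atTop, IsEnvelope P (termClass D s κ (a n) B (G n)) (H n))
    (hmom : IsOrder (fun n => ∫⁻ w, ENNReal.ofReal (H n w ^ 2) ∂P) a)
    (hbr : PolynomialBracketing P (fun n => termClass D s κ (a n) B (G n)) H) :
    DeviationOrder P D s κ a B G Q W (fun n => ((n : ℝ) * a n) ^ (-(1 / 2) : ℝ)) := by
  obtain ⟨C₀, hC₀⟩ := hmom
  obtain ⟨A, V, hA, hV, hbr⟩ := hbr
  set C : ℝ := C₀ + 1 with hC
  have hC0 : 0 < C := by positivity
  set L : ℝ := (V * (|Real.log A| + 2) + 1) * 1 with hL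
  have hL1 : 1 ≤ L := by
    have : 0 ≤ V * (|Real.log A| + 2) := by positivity
    rw [hL]
    linarith
  -- `100 = 88 + 6 * 2`; with `p = 2` the tail term has the same order as the main term.
  refine deviationOrder_of_expectedSupLE ha (C := 100 * (√C * √L)) (by positivity) ?_
  filter_upwards [henv, hC₀, hbr, eventually_ge_atTop 1] with n henv hmom hbr hn I hI hcard
  have han := ha n
  have hn0 : (0 : ℝ) < n := by exact_mod_cast hn
  have hm0 : 0 < I.card := by omega
  have hmn : (I.card : ℝ) ≤ n := by
    have := Finset.card_le_card hI
    rw [Finset.card_range] at this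
    exact_mod_cast this
  set σ : ℝ := √(C * a n) with hσ
  have hσ0 : 0 < σ := Real.sqrt_pos.2 (by positivity)
  have hσ2 : σ ^ 2 = C * a n := Real.sq_sqrt (by positivity)
  obtain ⟨hHi, hH2⟩ := integrable_of_lintegral_ofReal_le ((hH n).pow_const 2)
    (fun w => sq_nonneg _) (c := σ ^ 2) (by positivity) (hmom.trans (by
      rw [hσ2, ENNReal.ofReal_mul hC0.le]
      refine mul_le_mul_left ?_ _
      rw [← ENNReal.ofReal_coe_nnreal]
      exact ENNReal.ofReal_le_ofReal (by rw [hC]; linarith)))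
  obtain ⟨hHmem, hHnorm⟩ := memLp_two_of_integral_sq_le (hH n) hHi hσ0.le hH2
  have hE := expectedSupLE_of_bracketingNumber hW hind (Finset.card_pos.1 hm0)
    (F := termClass D s κ (a n) B (G n))
    (fun f ⟨z, _, β, _, hf⟩ => hf ▸ (measurable_normalizedTerm D s κ _ _ β _).aestronglyMeasurable)
    (hH n) hHmem henv hσ0 hL1
    (fun f hf => (eLpNorm_mono_ae (by
      filter_upwards [henv] with w hw
      exact (hw f hf).trans (le_abs_self _))).trans hHnorm) (fun k => by
      have h2k : (2 : ℝ) ^ k ≥ 1 := one_le_pow₀ (by norm_num)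
      -- The extra factor `2` keeps `ε < 1` at `k = 0`.
      refine le_trans ?_ ((hbr (1 / (2 * 2 ^ k)) ⟨by positivity, ?_⟩).trans
        (ENNReal.ofReal_le_ofReal ?_))
      · refine ENat.toENNReal_le.2 (bracketingNumber_anti ?_)
        refine (mul_le_mul_right hHnorm _).trans ?_
        rw [← ENNReal.ofReal_mul (by positivity)]
        refine ENNReal.ofReal_le_ofReal ?_
        rw [div_mul_eq_mul_div, one_mul]
        exact div_le_div_of_nonneg_left hσ0.le (by positivity) (by linarith)
      · rw [div_lt_one (by positivity)]
        linarith
      · have := rpow_le_exp_div_two hA hV two_pos le_rfl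
          (by linarith [Real.log_two_lt_d9] : Real.log 2 ≤ 1) k
        convert this using 2
        field_simp)
  refine hE.mono ?_
  set m : ℝ := (I.card : ℝ) with hm
  have hmp : 0 < m := by rw [hm]; exact_mod_cast hm0
  have hsm : 0 < √m := Real.sqrt_pos.2 hmp
  have hsL : 0 < √L := Real.sqrt_pos.2 (by linarith)
  have htail : m * ∫ w, envelopeTail (fun w => |H n w|) (√m * σ / √L) w ∂P
      ≤ 2 * (√m * σ * √L) := by
    have h1 := integral_envelopeTail_le (P := P) (H := H n) (p := 2) (T := √m * σ / √L) (m := σ ^ 2)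
      (by positivity) (by norm_num) (by simpa using hHi) (by simpa using hH2)
    refine (mul_le_mul_of_nonneg_left h1 hmp.le).trans (le_of_eq ?_)
    rw [show (2 : ℝ) - 1 = 1 by norm_num, Real.rpow_one]
    nth_rewrite 1 [← Real.mul_self_sqrt hmp.le]
    field_simp
  have hrate : (n : ℝ) * a n * ((n : ℝ) * a n) ^ (-(1 / 2) : ℝ) = √n * √(a n) := by
    have hna : 0 < (n : ℝ) * a n := by positivity
    rw [← Real.sqrt_mul hn0.le, Real.sqrt_eq_rpow]
    nth_rewrite 1 [← Real.rpow_one ((n : ℝ) * a n)]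
    rw [← Real.rpow_add hna]
    norm_num
  rw [hrate]
  have h1 : √m * σ * √L ≤ √C * √L * (√n * √(a n)) := by
    rw [hσ, Real.sqrt_mul hC0.le]
    have := mul_le_mul_of_nonneg_right (Real.sqrt_le_sqrt hmn)
      (show 0 ≤ √C * √(a n) * √L by positivity)
    linarith
  linarith

/-- The order of the deviations when the envelope has a bounded `r`-th moment, `r > 2`, and the
second moments of the functions are of order `a`. -/
theorem deviationOrder_of_moment [IsProbabilityMeasure P] [IsProbabilityMeasure Q]
    (hW : ∀ i, MeasurePreserving (W i) Q P) (hind : iIndepFun W Q) (D : EventHistory S d τ)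
    (s : ℝ → (Fin d → ℝ) → ℝ → ℝ) (κ : ℕ) {r : ℝ} (hr : 2 < r) {a : ℕ → ℝ} (ha : ∀ n, 0 < a n)
    (ha0 : Tendsto a atTop (𝓝 0))
    (hab : (fun n => (a n)⁻¹ * logRate a n ^ (r / 2 - 1)) =O[atTop] (fun _ => (1 : ℝ)))
    (B : Set (Fin d → ℝ)) (G : ℕ → Set (ℝ × ℝ)) {H : ℕ → S → ℝ} (hH : ∀ n, Measurable (H n))
    (henv : ∀ᶠ n in atTop, IsEnvelope P (termClass D s κ (a n) B (G n)) (H n))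
    (hmom : IsOrder (fun n => ∫⁻ w, ENNReal.ofReal (|H n w| ^ r) ∂P) (fun _ => 1))
    (hnorm : ∀ᶠ n in atTop, ∀ f ∈ termClass D s κ (a n) B (G n),
      eLpNorm f 2 P ≤ ENNReal.ofReal (√(a n)) * eLpNorm (H n) 2 P)
    (hbr : PolynomialBracketing P (fun n => termClass D s κ (a n) B (G n)) H) :
    DeviationOrder P D s κ a B G Q W (fun n => √(logRate a n)) := by
  obtain ⟨C₀, hC₀⟩ := hmom
  obtain ⟨A, V, hA, hV, hbr⟩ := hbr
  obtain ⟨C₁, hC₁pos, hC₁⟩ := hab.exists_pos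
  rw [Asymptotics.isBigOWith_iff] at hC₁
  set M : ℝ := C₀ + 1 with hM
  have hM1 : 1 ≤ M := by rw [hM]; linarith [C₀.2]
  have hM0 : 0 < M := by linarith
  set c : ℝ := V * (|Real.log A| + 2) + 1 with hc
  have hc1 : 1 ≤ c := by
    have : 0 ≤ V * (|Real.log A| + 2) := by positivity
    rw [hc]
    linarith
  set q : ℝ := 2 * √(2 * c) / M with hq
  refine deviationOrder_of_expectedSupLE ha
    (C := 88 * (M * √c) + 6 * (q ^ (r - 1) * M * C₁)) (by positivity) ?_
  -- This makes `log a⁻¹ ≥ 1`, so that the logarithm can absorb constants.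
  have hasmall : ∀ᶠ n in atTop, a n < Real.exp (-1) :=
    ha0.eventually_lt_const (Real.exp_pos _)
  filter_upwards [henv, hC₀, hbr, hnorm, hC₁, hasmall, eventually_ge_atTop 1] with
    n henv hmom hbr hnorm hC₁ hasmall hn I hI hcard
  have han := ha n
  have hn0 : (0 : ℝ) < n := by exact_mod_cast hn
  have hm0 : 0 < I.card := by omega
  have hmn : (I.card : ℝ) ≤ n := by
    have := Finset.card_le_card hI
    rw [Finset.card_range] at this
    exact_mod_cast this
  have hnm : (n : ℝ) ≤ 2 * I.card := by exact_mod_cast hcard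
  have ha1 : a n < 1 := hasmall.trans (by simp)
  set ell : ℝ := Real.log ((a n)⁻¹) with hell
  have hell1 : 1 ≤ ell := by
    rw [hell, Real.log_inv, le_neg]
    exact ((Real.log_lt_iff_lt_exp han).2 hasmall).le
  have hsa : 0 < √(a n) := Real.sqrt_pos.2 han
  have hsa1 : √(a n) < 1 := (Real.sqrt_lt' one_pos).2 (by simpa using ha1)
  set σ : ℝ := √(a n) * M with hσ
  have hσ0 : 0 < σ := by positivity
  have hL1 : 1 ≤ c * ell := one_le_mul_of_one_le_of_one_le hc1 hell1
  obtain ⟨hHri, hHr⟩ := integrable_of_lintegral_ofReal_le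
    (((hH n).abs).pow_const r) (fun w => by positivity) (c := C₀) C₀.2
    (by simpa using hmom)
  have hsq : ∀ w, H n w ^ 2 ≤ 1 + |H n w| ^ r := fun w => by
    have h0 : 0 ≤ |H n w| ^ r := by positivity
    rw [← sq_abs]
    rcases le_total |H n w| 1 with h | h
    · nlinarith [pow_le_one₀ (n := 2) (abs_nonneg (H n w)) h]
    · have := Real.rpow_le_rpow_of_exponent_le h hr.le
      rw [Real.rpow_two] at this
      linarith
  have hsumi : Integrable (fun w => 1 + |H n w| ^ r) P := (integrable_const _).add hHri
  have hHi : Integrable (fun w => H n w ^ 2) P :=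
    hsumi.mono' ((hH n).pow_const 2).aestronglyMeasurable (ae_of_all _ fun w => by
      rw [Real.norm_eq_abs, abs_of_nonneg (sq_nonneg _)]
      exact hsq w)
  have hH2 : ∫ w, H n w ^ 2 ∂P ≤ M ^ 2 := by
    refine (integral_mono hHi hsumi hsq).trans ?_
    rw [integral_add (integrable_const _) hHri]
    simp only [integral_const, probReal_univ, one_smul]
    nlinarith
  obtain ⟨hHmem, hHnorm⟩ := memLp_two_of_integral_sq_le (hH n) hHi hM0.le hH2
  have hE := expectedSupLE_of_bracketingNumber hW hind (Finset.card_pos.1 hm0)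
    (F := termClass D s κ (a n) B (G n))
    (fun f ⟨z, _, β, _, hf⟩ => hf ▸ (measurable_normalizedTerm D s κ _ _ β _).aestronglyMeasurable)
    (hH n) hHmem henv hσ0 hL1
    (fun f hf => (hnorm f hf).trans (by
      rw [hσ, ENNReal.ofReal_mul hsa.le]
      exact mul_le_mul_right hHnorm _)) (fun k => by
      have h2k : (2 : ℝ) ^ k ≥ 1 := one_le_pow₀ (by norm_num)
      -- The brackets have to be of size `√a` relative to the envelope; this is where the logarithm
      -- of `a⁻¹` enters.
      refine le_trans ?_ ((hbr (√(a n) / 2 ^ k) ⟨by positivity, ?_⟩).trans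
        (ENNReal.ofReal_le_ofReal ?_))
      · refine ENat.toENNReal_le.2 (bracketingNumber_anti ?_)
        refine (mul_le_mul_right hHnorm _).trans ?_
        rw [← ENNReal.ofReal_mul (by positivity), hσ, div_mul_eq_mul_div]
      · rw [div_lt_one (by positivity)]
        linarith
      · have hlog : Real.log (√(a n))⁻¹ ≤ ell := by
          rw [hell, Real.log_inv, Real.log_inv, Real.log_sqrt han.le]
          rw [hell, Real.log_inv] at hell1
          linarith
        have := rpow_le_exp_div_two hA hV (inv_pos.2 hsa) hell1 hlog k
        convert this using 2
        field_simp)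
  refine hE.mono ?_
  set m : ℝ := (I.card : ℝ) with hm
  have hmp : 0 < m := by rw [hm]; exact_mod_cast hm0
  have hsm : 0 < √m := Real.sqrt_pos.2 hmp
  have hsn : 0 < √(n : ℝ) := Real.sqrt_pos.2 hn0
  have hL0 : 0 < √(c * ell) := Real.sqrt_pos.2 (by linarith)
  set b : ℝ := logRate a n with hb
  have hbdef : b = ell / (n * a n) := rfl
  have hb0 : 0 < b := by rw [hbdef]; positivity
  have hsb : √b = √ell / (√n * √(a n)) := by
    rw [hbdef, Real.sqrt_div (by linarith), Real.sqrt_mul hn0.le]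
  have hfirst : √m * σ * √(c * ell) ≤ M * √c * (n * a n * √b) := by
    have h1 : (n : ℝ) * a n * √b = √n * √(a n) * √ell := by
      rw [hsb]
      nth_rewrite 1 [← Real.mul_self_sqrt hn0.le, ← Real.mul_self_sqrt han.le]
      field_simp
    rw [h1, hσ, Real.sqrt_mul (by linarith)]
    have := mul_le_mul_of_nonneg_right (Real.sqrt_le_sqrt hmn)
      (show 0 ≤ √(a n) * M * (√c * √ell) by positivity)
    linarith
  -- The truncation point is of order `b^(-1/2)`; `n ≤ 2 m` accounts for the `√2` in `q`.
  have hT : 2 / (√m * σ / √(c * ell)) ≤ q * √b := by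
    have h1 : √(n : ℝ) ≤ √2 * √m := by
      rw [← Real.sqrt_mul (by norm_num)]
      exact Real.sqrt_le_sqrt hnm
    rw [hsb, hq, hσ, Real.sqrt_mul (by linarith), Real.sqrt_mul (by norm_num)]
    rw [show 2 / (√m * (√(a n) * M) / (√c * √ell)) = 2 * √c * √ell / (M * √(a n)) * (1 / √m) by
        field_simp,
      show 2 * (√2 * √c) / M * (√ell / (√n * √(a n)))
        = 2 * √c * √ell / (M * √(a n)) * (√2 / √n) by field_simp]
    refine mul_le_mul_of_nonneg_left ?_ (by positivity)
    rw [div_le_div_iff₀ hsm hsn]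
    linarith
  have hbr' : b ^ (r / 2 - 1) ≤ C₁ * a n := by
    have h1 := (le_abs_self _).trans hC₁
    rw [norm_one, mul_one, inv_mul_le_iff₀ han] at h1
    linarith
  have htail : m * ∫ w, envelopeTail (fun w => |H n w|) (√m * σ / √(c * ell)) w ∂P
      ≤ q ^ (r - 1) * M * C₁ * (n * a n * √b) := by
    have h1 := integral_envelopeTail_le (P := P) (H := H n) (p := r) (T := √m * σ / √(c * ell))
      (m := M) (by positivity) (by linarith) hHri (hHr.trans (by rw [hM]; linarith))
    have hqb : (2 / (√m * σ / √(c * ell))) ^ (r - 1) ≤ q ^ (r - 1) * (√b * (C₁ * a n)) := by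
      refine (Real.rpow_le_rpow (by positivity) hT (by linarith)).trans ?_
      rw [Real.mul_rpow (by positivity) (by positivity)]
      refine mul_le_mul_of_nonneg_left ?_ (by positivity)
      -- The second factor is at most `C₁ * a n` by the bandwidth condition, which supplies the
      -- missing factor `a`.
      have h2 : √b ^ (r - 1) = √b * b ^ (r / 2 - 1) := by
        rw [Real.sqrt_eq_rpow, ← Real.rpow_mul hb0.le, ← Real.rpow_add hb0]
        congr 1
        ring
      rw [h2]
      exact mul_le_mul_of_nonneg_left hbr' (Real.sqrt_nonneg _)
    have h3 : 0 ≤ q ^ (r - 1) * (√b * (C₁ * a n)) * M := by positivity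
    calc m * ∫ w, envelopeTail (fun w => |H n w|) (√m * σ / √(c * ell)) w ∂P
        ≤ m * (q ^ (r - 1) * (√b * (C₁ * a n)) * M) :=
          mul_le_mul_of_nonneg_left (h1.trans (mul_le_mul_of_nonneg_right hqb hM0.le)) hmp.le
      _ ≤ n * (q ^ (r - 1) * (√b * (C₁ * a n)) * M) := mul_le_mul_of_nonneg_right hmn h3
      _ = _ := by ring
  linarith

end Rates

end KernelRisk

end

theorem proposition3p6
    {S Ω : Type*} [MeasurableSpace S] [MeasurableSpace Ω]
    (P : Measure S) [IsProbabilityMeasure P] (Q : Measure Ω) [IsProbabilityMeasure Q]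
    {d : ℕ} {τ τ₀ : ℝ} (D : KernelRisk.EventHistory S d τ) (B : Set (Fin d → ℝ))
    (κ : ℕ) (hκ : 1 ≤ κ)
    (hfin : KernelRisk.FiniteRisk P D τ₀ B)
    (s : ℝ → (Fin d → ℝ) → ℝ → ℝ) (hs : KernelRisk.IsRiskDensity P D τ₀ B s)
    (hs_pos : ∀ u ∈ Icc 0 τ₀, ∀ β ∈ B, ∀ x ∈ Icc 0 τ, 0 < s u β x)
    -- the sample
    (W : ℕ → Ω → S) (hW_meas : ∀ i, Measurable (W i)) (hW_law : ∀ i, Q.map (W i) = P)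
    (hW_indep : iIndepFun W Q)
    -- the bandwidth
    (r : ℝ) (hr : 2 < r) (a : ℕ → ℝ) (ha_pos : ∀ n, 0 < a n)
    (ha : Tendsto a atTop (𝓝 0)) (hna : Tendsto (fun n : ℕ => (n : ℝ) * a n) atTop atTop)
    (hb : Tendsto (KernelRisk.logRate a) atTop (𝓝 0))
    (hab : (fun n => (a n)⁻¹ * KernelRisk.logRate a n ^ (r / 2 - 1)) =O[atTop]
      (fun _ => (1 : ℝ)))
    -- the envelope and the bracketing numbers in the central region
    (H₁ : ℕ → S → ℝ) (hH₁_meas : ∀ n, Measurable (H₁ n))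
    (hH₁_env : ∀ᶠ n in atTop, KernelRisk.IsEnvelope P
      (KernelRisk.termClass D s κ (a n) B (KernelRisk.centralRegion τ₀ τ (a n))) (H₁ n))
    (hH₁_moment : KernelRisk.IsOrder (fun n => ∫⁻ w, ENNReal.ofReal (|H₁ n w| ^ r) ∂P)
      (fun _ => 1))
    (hH₁_norm : ∀ᶠ n in atTop,
      ∀ f ∈ KernelRisk.termClass D s κ (a n) B (KernelRisk.centralRegion τ₀ τ (a n)),
        eLpNorm f 2 P ≤ ENNReal.ofReal (√(a n)) * eLpNorm (H₁ n) 2 P)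
    (hH₁_bracket : KernelRisk.PolynomialBracketing P
      (fun n => KernelRisk.termClass D s κ (a n) B (KernelRisk.centralRegion τ₀ τ (a n))) H₁) :
    KernelRisk.DeviationOrder P D s κ a B (fun n => KernelRisk.centralRegion τ₀ τ (a n)) Q W
        (fun n => √(KernelRisk.logRate a n)) ∧
    ∀ G : ℝ → Set (ℝ × ℝ),
      (G = KernelRisk.leftRegion τ₀ τ ∨ G = KernelRisk.rightRegion τ₀ τ) →
      ∀ H : ℕ → S → ℝ, (∀ n, Measurable (H n)) →
        (∀ᶠ n in atTop, KernelRisk.IsEnvelope P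
          (KernelRisk.termClass D s κ (a n) B (G (a n))) (H n)) →
        KernelRisk.IsOrder (fun n => ∫⁻ w, ENNReal.ofReal (H n w ^ 2) ∂P) a →
        KernelRisk.PolynomialBracketing P
          (fun n => KernelRisk.termClass D s κ (a n) B (G (a n))) H →
        KernelRisk.DeviationOrder P D s κ a B (fun n => G (a n)) Q W
          (fun n => ((n : ℝ) * a n) ^ (-(1 / 2) : ℝ)) := by
  have hW : ∀ i, MeasurePreserving (W i) Q P := fun i => ⟨hW_meas i, hW_law i⟩
  refine ⟨KernelRisk.deviationOrder_of_moment hW hW_indep D s κ hr ha_pos ha hab B _ hH₁_meas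
    hH₁_env hH₁_moment hH₁_norm hH₁_bracket, fun G _ H hH henv hmom hbr => ?_⟩
  exact KernelRisk.deviationOrder_of_secondMoment hW hW_indep D s κ ha_pos B (fun n => G (a n)) hH
    henv hmom hbr
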